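/- There is a deterministic polynomial-time algorithm with the following property. Its input consists of integers $m\ge 0$, $n\ge 1$, $c\ge 1$ and a family of vectors $v^{j,r}\in\mathbb{Q}^m$ for $1\le j\le n$, $1\le r\le c$ (all of $m,n,c$ are part of the input; the vectors are listed one after the other and each coordinate is given as a fraction in lowest terms with numerator and denominator in binary). Its output is a coloring $\chi\colon\{1,\dots,n\}\to\{1,\dots,c\}$ such that for each $1\le i\le m$ \[ \left|\frac{1}{c}\sum_{j=1}^n\sum_{r=1}^c v^{j,r}_i-\sum_{j=1}^n v^{j,\chi(j)}_i\right|\le 2m\max_{j,r}|v^{j,r}_i| . \] The running time is bounded by a polynomial in the length of the input word. -/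

import Mathlib

namespace MultiColor

/-- The finite alphabet in which inputs and outputs are written. -/
inductive Letter
  | zero
  | one
  | minus
  | slash
  | comma
  | semicolon
  | bar
  deriving DecidableEq

instance : Fintype Letter where
  elems := {.zero, .one, .minus, .slash, .comma, .semicolon, .bar}
  complete := by intro x; cases x <;> decide

/-- A natural number in binary, least significant bit first; the number `0` is the empty word. -/
def encodeNat (k : ℕ) : List Letter :=
  (Computability.encodeNat k).map fun b => if b then Letter.one else Letter.zero

/-- A rational number in lowest terms, written as (sign) numerator / denominator. -/
def encodeRat (q : ℚ) : List Letter :=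
  (if q < 0 then [Letter.minus] else []) ++ encodeNat q.num.natAbs ++ [Letter.slash] ++
    encodeNat q.den

/-- An input: a family of vectors `v j r ∈ ℚ ^ m` for `n ≥ 1` items `j` and `c ≥ 1` colors `r`.
The dimension `m`, the number of items and the number of colors are all part of the input. -/
structure Input where
  m : ℕ
  n : ℕ
  c : ℕ
  n_pos : 0 < n
  c_pos : 0 < c
  v : Fin n → Fin c → Fin m → ℚ

/-- The word that is handed to the algorithm: the coordinates of a vector are each followed by
a comma, each vector is followed by a semicolon, and the vectors of each item by a bar. -/
def encodeInput (I : Input) : List Letter :=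
  (List.ofFn fun j : Fin I.n =>
    (List.ofFn fun r : Fin I.c =>
      (List.ofFn fun i : Fin I.m => encodeRat (I.v j r i) ++ [Letter.comma]).flatten
        ++ [Letter.semicolon]).flatten ++ [Letter.bar]).flatten

/-- A finite sequence of natural numbers, each written in binary and followed by a comma. -/
def encodeNatList (l : List ℕ) : List Letter :=
  (l.map fun k => encodeNat k ++ [Letter.comma]).flatten

/-- The coloring `χ` as the sequence of its values (colors are numbered `0, …, c - 1`). -/
def colorSeq {n c : ℕ} (χ : Fin n → Fin c) : List ℕ :=
  List.ofFn fun j => (χ j : ℕ)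

/-- The maximum over all `j, r` of the absolute value of coordinate `i` of `v j r`. -/
def Input.maxAbs (I : Input) (i : Fin I.m) : ℚ :=
  (Finset.univ : Finset (Fin I.n × Fin I.c)).sup'
    ⟨(⟨0, I.n_pos⟩, ⟨0, I.c_pos⟩), Finset.mem_univ _⟩ fun p => |I.v p.1 p.2 i|

end MultiColor

/-! Give each pair of an item and a color a weight, and consider the `n + m` linear equations saying
that the weights of every item add up to `c` and that the weighted sum of the vectors is the sum of
all vectors. Setting all weights to 1 solves them, so there is also a nonnegative solution with at
most `n + m` nonzero weights (Carathéodory). Divided by `c`, its weights form a probability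
distribution on the colors of each item, and the mean is the one in the theorem. Now round: item `j`
takes some color of positive weight. If only one weight of `j` is positive, it equals 1 and nothing
changes; if `k ≥ 2` are positive, coordinate `i` changes by at most twice the maximum, hence by at
most `2 (k - 1)` times it. Every item uses at least one of the at most `n + m` positive weights, so
the numbers `k - 1` add up to at most `m` (`abs_sum_sub_sum_le`).

The sparse solution is found by inserting the columns one at a time. A nonsingular matrix `B`, at
first the identity with artificial columns of weight 0, expresses the sum of the columns treated so
far with nonnegative coefficients. A new column of weight 1 is traded for its expansion in `B` until
this is complete or a ratio test stops it; in the latter case the column enters the basis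
(`Valid.step`). The arithmetic is fraction-free: all coefficients are integers over the common
denominator `|det B|`. By Cramer's rule they are determinants up to sign (`natAbs_det_updateCol`),
so their binary lengths stay polynomial (`size_le_of_valid`).

For the running time, structured stack programs are compiled to Turing machines (`Run.steps`). Data
are coded as binary trees, and `PolyTime` is closed under composition, pairing, case distinction and
folds whose states stay of polynomial size. The algorithm is written with these operations only. -/

namespace MultiColor

/-! ### Structured stack programs and their compilation to Turing machines -/

/-- The stacks of the machine: input and output, two data stacks, and two scratch stacks that are
empty between any two operations. -/
inductive Stk
  | io
  | data
  | aux
  | copy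
  | count
  deriving DecidableEq

instance : Fintype Stk where
  elems := {.io, .data, .aux, .copy, .count}
  complete := by intro x; cases x <;> decide

/-- The contents of all stacks. -/
structure Mem where
  io : List Letter
  data : List Letter
  aux : List Letter
  copy : List Letter
  count : List Letter

def Mem.get (s : Mem) : Stk → List Letter
  | .io => s.io
  | .data => s.data
  | .aux => s.aux
  | .copy => s.copy
  | .count => s.count

def Mem.set (s : Mem) (k : Stk) (l : List Letter) : Mem :=
  match k with
  | .io => { s with io := l }
  | .data => { s with data := l }
  | .aux => { s with aux := l }
  | .copy => { s with copy := l }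
  | .count => { s with count := l }

theorem Mem.get_set (s : Mem) (k : Stk) (l : List Letter) :
    (s.set k l).get = Function.update s.get k l := by
  funext k'
  cases k <;> cases k' <;> simp [Mem.get, Mem.set, Function.update]

/-- Structured programs over the stacks. Tests look at the top of a stack. -/
inductive Prog
  | push (k : Stk) (a : Letter)
  | pop (k : Stk)
  | seq (p q : Prog)
  | ite (k : Stk) (f : Option Letter → Bool) (p q : Prog)
  | loop (k : Stk) (f : Option Letter → Bool) (p : Prog)

/-- `Run p s s' t`: started with memory `s`, the program `p` ends with memory `s'` after exactly
`t` steps. -/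
inductive Run : Prog → Mem → Mem → ℕ → Prop
  | push (k a s) : Run (.push k a) s (s.set k (a :: s.get k)) 1
  | pop (k s) : Run (.pop k) s (s.set k (s.get k).tail) 1
  | seq {p q s s' s'' t t'} : Run p s s' t → Run q s' s'' t' → Run (.seq p q) s s'' (t + t')
  | ite_true {k f p q s s' t} : f (s.get k).head? = true → Run p s s' t →
      Run (.ite k f p q) s s' (1 + t)
  | ite_false {k f p q s s' t} : f (s.get k).head? = false → Run q s s' t →
      Run (.ite k f p q) s s' (1 + t)
  | loop_done {k f p s} : f (s.get k).head? = false → Run (.loop k f p) s s 1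
  | loop_step {k f p s s' s'' t t'} : f (s.get k).head? = true → Run p s s' t →
      Run (.loop k f p) s' s'' t' → Run (.loop k f p) s s'' (1 + t + t')

/-- The labels of the machine code for a program. -/
def Lbl : Prog → Type
  | .push _ _ => Unit
  | .pop _ => Unit
  | .seq p q => Lbl p ⊕ Lbl q
  | .ite _ _ p q => Option (Lbl p ⊕ Lbl q)
  | .loop _ _ p => Option (Lbl p)

/-- The first label of the machine code for a program. -/
def entry : (p : Prog) → Lbl p
  | .push _ _ => ()
  | .pop _ => ()
  | .seq p _ => Sum.inl (entry p)
  | .ite _ _ _ _ => none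
  | .loop _ _ _ => none

@[reducible]
noncomputable def lblFintype : (p : Prog) → Fintype (Lbl p)
  | .push _ _ => inferInstanceAs (Fintype Unit)
  | .pop _ => inferInstanceAs (Fintype Unit)
  | .seq p q =>
    letI := lblFintype p
    letI := lblFintype q
    inferInstanceAs (Fintype (Lbl p ⊕ Lbl q))
  | .ite _ _ p q =>
    letI := lblFintype p
    letI := lblFintype q
    inferInstanceAs (Fintype (Option (Lbl p ⊕ Lbl q)))
  | .loop _ _ p =>
    letI := lblFintype p
    inferInstanceAs (Fintype (Option (Lbl p)))

/-- Machine statements over the label type `L`; the state holds the letter looked at last. -/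
abbrev Code (L : Type) : Type := Turing.TM2.Stmt (fun _ : Stk => Letter) L (Option Letter)

/-- The machine code for a program, whose labels are embedded by `e` into the labels of a larger
machine, and which jumps to `x` at its end. -/
def code {L : Type} : (p : Prog) → (e : Lbl p → L) → (x : L) → Lbl p → Code L
  | .push k a, _, x, _ => .push k (fun _ => a) (.goto fun _ => x)
  | .pop k, _, x, _ => .pop k (fun v _ => v) (.goto fun _ => x)
  | .seq p q, e, x, l =>
    match l with
    | .inl l => code p (fun l => e (.inl l)) (e (.inr (entry q))) l
    | .inr l => code q (fun l => e (.inr l)) x l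
  | .ite k f p q, e, x, l =>
    match l with
    | none => .peek k (fun _ a => a) (.goto fun v =>
        if f v then e (some (.inl (entry p))) else e (some (.inr (entry q))))
    | some (.inl l) => code p (fun l => e (some (.inl l))) x l
    | some (.inr l) => code q (fun l => e (some (.inr l))) x l
  | .loop k f p, e, x, l =>
    match l with
    | none => .peek k (fun _ a => a) (.goto fun v => if f v then e (some (entry p)) else x)
    | some l => code p (fun l => e (some l)) (e none) l

/-- `Steps M t c c'`: the machine `M` gets from `c` to `c'` in exactly `t` steps. -/
def Steps {L : Type} (M : L → Code L) (t : ℕ)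
    (c c' : Turing.TM2.Cfg (fun _ : Stk => Letter) L (Option Letter)) : Prop :=
  (fun o => o.bind (Turing.TM2.step M))^[t] (some c) = some c'

theorem Steps.trans {L : Type} {M : L → Code L} {t t' : ℕ}
    {c c' c'' : Turing.TM2.Cfg (fun _ : Stk => Letter) L (Option Letter)}
    (h : Steps M t c c') (h' : Steps M t' c' c'') : Steps M (t + t') c c'' := by
  unfold Steps at *
  rw [Nat.add_comm, Function.iterate_add_apply, h, h']

theorem Steps.single {L : Type} {M : L → Code L} {l : L} {v : Option Letter}
    {S : Stk → List Letter} {c' : Turing.TM2.Cfg (fun _ : Stk => Letter) L (Option Letter)}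
    (h : Turing.TM2.stepAux (M l) v S = c') : Steps M 1 ⟨some l, v, S⟩ c' := by
  simp [Steps, h]

/-- Induction on the run. The ambient machine, the embedding of the labels and the exit label are
arbitrary because a subprogram is executed inside the code of a larger one. The remembered letter is
arbitrary as well: every test looks at its stack before it branches. -/
theorem Run.steps {p : Prog} {s s' : Mem} {t : ℕ} (h : Run p s s' t) :
    ∀ {L : Type} (M : L → Code L) (e : Lbl p → L) (x : L), (∀ l, M (e l) = code p e x l) →
      ∀ v, ∃ v', Steps M t ⟨some (e (entry p)), v, s.get⟩ ⟨some x, v', s'.get⟩ := by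
  induction h with
  | push k a s =>
    intro L M e x hM v
    exact ⟨v, Steps.single (by rw [hM, Mem.get_set]; rfl)⟩
  | pop k s =>
    intro L M e x hM v
    exact ⟨v, Steps.single (by rw [hM, Mem.get_set]; rfl)⟩
  | @seq p q _ _ _ _ _ _ _ ihp ihq =>
    intro L M e x hM v
    obtain ⟨v₁, h₁⟩ := ihp M (fun l => e (.inl l)) (e (.inr (entry q))) (fun l => hM (.inl l)) v
    obtain ⟨v₂, h₂⟩ := ihq M (fun l => e (.inr l)) x (fun l => hM (.inr l)) v₁
    exact ⟨v₂, h₁.trans h₂⟩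
  | @ite_true k f p q s _ _ hf _ ih =>
    intro L M e x hM v
    obtain ⟨v₁, h₁⟩ := ih M (fun l => e (some (.inl l))) x (fun l => hM (some (.inl l)))
      (s.get k).head?
    refine ⟨v₁, Steps.trans (Steps.single ?_) h₁⟩
    rw [hM]
    simp [entry, code, hf]
  | @ite_false k f p q s _ _ hf _ ih =>
    intro L M e x hM v
    obtain ⟨v₁, h₁⟩ := ih M (fun l => e (some (.inr l))) x (fun l => hM (some (.inr l)))
      (s.get k).head?
    refine ⟨v₁, Steps.trans (Steps.single ?_) h₁⟩
    rw [hM]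
    simp [entry, code, hf]
  | @loop_done k f p s hf =>
    intro L M e x hM v
    refine ⟨(s.get k).head?, Steps.single ?_⟩
    rw [hM]
    simp [entry, code, hf]
  | @loop_step k f p s _ _ _ _ hf _ _ ihp ihl =>
    intro L M e x hM v
    obtain ⟨v₁, h₁⟩ := ihp M (fun l => e (some l)) (e none) (fun l => hM (some l))
      (s.get k).head?
    obtain ⟨v₂, h₂⟩ := ihl M e x hM v₁
    refine ⟨v₂, Steps.trans (Steps.trans (Steps.single ?_) h₁) h₂⟩
    rw [hM]
    simp [entry, code, hf]

/-- The machine that runs a program on the input stack and halts. -/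
noncomputable def machine (p : Prog) : Turing.FinTM2 :=
  letI := lblFintype p
  { K := Stk
    k₀ := .io
    k₁ := .io
    Γ := fun _ => Letter
    Λ := Option (Lbl p)
    main := some (entry p)
    σ := Option Letter
    initialState := none
    Γk₀Fin := inferInstanceAs (Fintype Letter)
    m := fun l =>
      match l with
      | none => .load (fun _ => none) .halt
      | some l => code p some none l }

/-- A program that turns each input word into the output word in polynomial time yields a machine
that does so. -/
theorem nonempty_computable_of_run {α β : Type} {ea : α → List Letter} {eb : β → List Letter}
    {f : α → β} (p : Prog) (q : Polynomial ℕ)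
    (h : ∀ a, ∃ t ≤ q.eval (ea a).length, Run p ⟨ea a, [], [], [], []⟩ ⟨eb (f a), [], [], [], []⟩ t) :
    Nonempty (Turing.TM2ComputableInPolyTime ea eb f) := by
  refine ⟨{ tm := machine p, inputAlphabet := Equiv.refl Letter,
            outputAlphabet := Equiv.refl Letter, time := q + 1, outputsFun := fun a => ?_ }⟩
  have key : ∃ t ≤ (q + 1).eval (ea a).length, Steps (machine p).m t
      ⟨some (some (entry p)), none, (Mem.mk (ea a) [] [] [] []).get⟩
      ⟨none, none, (Mem.mk (eb (f a)) [] [] [] []).get⟩ := by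
    obtain ⟨t, ht, hr⟩ := h a
    obtain ⟨v, hs⟩ := hr.steps (machine p).m some none (fun _ => rfl) none
    -- The extra step executes the halting statement, which also resets the remembered letter to its
    -- initial value, as a final configuration requires.
    refine ⟨t + 1, by simpa using ht, hs.trans (Steps.single rfl)⟩
  have hin : Turing.initList (machine p) (List.map (Equiv.refl Letter).invFun (ea a)) =
      ⟨some (some (entry p)), none, (Mem.mk (ea a) [] [] [] []).get⟩ := by
    refine congrArg (Turing.TM2.Cfg.mk _ _) (funext fun k => ?_)
    cases k <;> simp [Mem.get, machine]
    rfl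
  have hout : Turing.haltList (machine p) (List.map (Equiv.refl Letter).invFun (eb (f a))) =
      ⟨none, none, (Mem.mk (eb (f a)) [] [] [] []).get⟩ := by
    refine congrArg (Turing.TM2.Cfg.mk _ _) (funext fun k => ?_)
    cases k <;> simp [Mem.get, machine]
    rfl
  refine { steps := key.choose, steps_le_m := key.choose_spec.1, evals_in_steps := ?_ }
  rw [Option.map_some, hin, hout]
  exact key.choose_spec.2

end MultiColor

/-! ### Binary trees on the stacks: deleting, moving and duplicating -/

namespace MultiColor

/-- Binary trees, into which all intermediate results are encoded. -/
inductive Dat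
  | nil
  | node (a b : Dat)

/-- The prefix code of a tree. -/
def ser : Dat → List Letter
  | .nil => [.zero]
  | .node a b => .one :: (ser a ++ ser b)

/-- `RunIn p s s' t`: started with memory `s`, the program `p` ends with memory `s'` after at most
`t` steps. -/
def RunIn (p : Prog) (s s' : Mem) (t : ℕ) : Prop := ∃ t' ≤ t, Run p s s' t'

namespace RunIn

variable {p q : Prog} {k : Stk} {f : Option Letter → Bool} {s s' s'' : Mem} {t t' : ℕ}

theorem mono (h : RunIn p s s' t) (ht : t ≤ t') : RunIn p s s' t' :=
  let ⟨u, hu, h⟩ := h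
  ⟨u, hu.trans ht, h⟩

theorem push (k a s) : RunIn (.push k a) s (s.set k (a :: s.get k)) 1 := ⟨1, le_rfl, .push k a s⟩

theorem pop (k s) : RunIn (.pop k) s (s.set k (s.get k).tail) 1 := ⟨1, le_rfl, .pop k s⟩

theorem seq (h : RunIn p s s' t) (h' : RunIn q s' s'' t') : RunIn (.seq p q) s s'' (t + t') :=
  let ⟨u, hu, h⟩ := h
  let ⟨u', hu', h'⟩ := h'
  ⟨u + u', by omega, h.seq h'⟩

theorem ite_true (hf : f (s.get k).head? = true) (h : RunIn p s s' t) :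
    RunIn (.ite k f p q) s s' (1 + t) :=
  let ⟨u, hu, h⟩ := h
  ⟨1 + u, by omega, h.ite_true hf⟩

theorem ite_false (hf : f (s.get k).head? = false) (h : RunIn q s s' t) :
    RunIn (.ite k f p q) s s' (1 + t) :=
  let ⟨u, hu, h⟩ := h
  ⟨1 + u, by omega, h.ite_false hf⟩

theorem loop_done (hf : f (s.get k).head? = false) : RunIn (.loop k f p) s s 1 :=
  ⟨1, le_rfl, .loop_done hf⟩

theorem loop_step (hf : f (s.get k).head? = true) (h : RunIn p s s' t)
    (h' : RunIn (.loop k f p) s' s'' t') : RunIn (.loop k f p) s s'' (1 + t + t') :=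
  let ⟨u, hu, h⟩ := h
  let ⟨u', hu', h'⟩ := h'
  ⟨1 + u + u', by omega, h.loop_step hf h'⟩

end RunIn

/-- A step pushes at most one letter. This is what bounds the size of a result by the running time
of its computation. -/
theorem Run.length_data_le {p : Prog} {s s' : Mem} {t : ℕ} (h : Run p s s' t) :
    s'.data.length ≤ s.data.length + t := by
  induction h with
  | push k a s => cases k <;> simp [Mem.set, Mem.get]
  | pop k s => cases k <;> simp [Mem.set, Mem.get]; omega
  | _ => omega

infixr:60 " ⨾ " => Prog.seq

/-- The test whether the letter looked at is `a`. -/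
def isLetter (a : Letter) (v : Option Letter) : Bool := v = some a

/-- The test whether the letter looked at is a bit. -/
def isBit (v : Option Letter) : Bool := v = some .zero ∨ v = some .one

/-- Does nothing. -/
def skip : Prog := .loop .data (fun _ => false) (.pop .data)

theorem runIn_skip (s : Mem) : RunIn skip s s 1 := .loop_done rfl

/-- Removes the first tree of the data stack. -/
def dropTree : Prog :=
  .push .count .zero ⨾ .loop .count Option.isSome
    (.ite .data (isLetter .one) (.pop .data ⨾ .push .count .zero) (.pop .data ⨾ .pop .count))

/-- The count stack holds one mark per tree still to be removed: a node replaces one pending tree by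
two, a leaf settles one. Phrasing the claim as "whatever the loop does afterwards" lets the
induction hypotheses for the two subtrees be chained. -/
theorem runIn_dropTree_loop (d : Dat) : ∀ {io x y z c s' t},
    RunIn (.loop .count Option.isSome
      (.ite .data (isLetter .one) (.pop .data ⨾ .push .count .zero) (.pop .data ⨾ .pop .count)))
      ⟨io, x, y, z, c⟩ s' t →
    RunIn (.loop .count Option.isSome
      (.ite .data (isLetter .one) (.pop .data ⨾ .push .count .zero) (.pop .data ⨾ .pop .count)))
      ⟨io, ser d ++ x, y, z, .zero :: c⟩ s' (t + 4 * (ser d).length) := by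
  induction d with
  | nil =>
    intro io x y z c s' t h
    exact (RunIn.loop_step rfl (.ite_false rfl (.seq (.pop _ _) (.pop _ _))) h).mono
      (by simp [ser]; omega)
  | node a b iha ihb =>
    intro io x y z c s' t h
    have := RunIn.loop_step (s := ⟨io, .one :: (ser a ++ (ser b ++ x)), y, z, .zero :: c⟩)
      (k := .count) (f := Option.isSome) rfl
      (.ite_true (k := .data) (f := isLetter .one) (q := .pop .data ⨾ .pop .count) rfl
        (.seq (.pop .data _) (.push .count .zero _))) (iha (ihb h))
    rw [show ser (a.node b) ++ x = .one :: (ser a ++ (ser b ++ x)) by simp [ser]]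
    exact this.mono (by simp [ser]; omega)

theorem runIn_dropTree (d : Dat) (io x y z) :
    RunIn dropTree ⟨io, ser d ++ x, y, z, []⟩ ⟨io, x, y, z, []⟩ (2 + 4 * (ser d).length) :=
  (RunIn.seq (.push _ _ _) (runIn_dropTree_loop d (.loop_done rfl))).mono (by omega)

/-- Moves the first tree of the data stack to the auxiliary stack, reversed and preceded by a
bar. -/
def toAux : Prog :=
  .push .aux .bar ⨾ .push .count .zero ⨾ .loop .count Option.isSome
    (.ite .data (isLetter .one) (.pop .data ⨾ .push .aux .one ⨾ .push .count .zero)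
      (.pop .data ⨾ .push .aux .zero ⨾ .pop .count))

theorem runIn_toAux_loop (d : Dat) : ∀ {io x y z c s' t},
    RunIn (.loop .count Option.isSome
      (.ite .data (isLetter .one) (.pop .data ⨾ .push .aux .one ⨾ .push .count .zero)
        (.pop .data ⨾ .push .aux .zero ⨾ .pop .count)))
      ⟨io, x, (ser d).reverse ++ y, z, c⟩ s' t →
    RunIn (.loop .count Option.isSome
      (.ite .data (isLetter .one) (.pop .data ⨾ .push .aux .one ⨾ .push .count .zero)
        (.pop .data ⨾ .push .aux .zero ⨾ .pop .count)))
      ⟨io, ser d ++ x, y, z, .zero :: c⟩ s' (t + 5 * (ser d).length) := by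
  induction d with
  | nil =>
    intro io x y z c s' t h
    exact (RunIn.loop_step rfl (.ite_false rfl (.seq (.pop _ _) (.seq (.push _ _ _) (.pop _ _))))
      h).mono (by simp [ser]; omega)
  | node a b iha ihb =>
    intro io x y z c s' t h
    have := RunIn.loop_step (s := ⟨io, .one :: (ser a ++ (ser b ++ x)), y, z, .zero :: c⟩)
      (k := .count) (f := Option.isSome) rfl
      (.ite_true (k := .data) (f := isLetter .one)
        (q := .pop .data ⨾ .push .aux .zero ⨾ .pop .count) rfl
        (.seq (.pop .data _) (.seq (.push .aux .one _) (.push .count .zero _))))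
        (iha (ihb (by simpa [ser, Mem.set, Mem.get] using h)))
    rw [show ser (a.node b) ++ x = .one :: (ser a ++ (ser b ++ x)) by simp [ser]]
    exact this.mono (by simp [ser]; omega)

theorem runIn_toAux (d : Dat) (io x y z) :
    RunIn toAux ⟨io, ser d ++ x, y, z, []⟩ ⟨io, x, (ser d).reverse ++ .bar :: y, z, []⟩
      (3 + 5 * (ser d).length) :=
  (RunIn.seq (.push _ _ _) (.seq (.push _ _ _) (runIn_toAux_loop d (.loop_done rfl)))).mono
    (by omega)

/-- Moves letters from the auxiliary stack to the data stack, up to the next bar. -/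
def fromAux : Prog :=
  .loop .aux isBit
    (.ite .aux (isLetter .one) (.pop .aux ⨾ .push .data .one) (.pop .aux ⨾ .push .data .zero)) ⨾
  .pop .aux

theorem runIn_fromAux_loop (l : List Letter) : ∀ {io x y z c},
    (∀ a ∈ l, a = .zero ∨ a = .one) →
    RunIn (.loop .aux isBit
      (.ite .aux (isLetter .one) (.pop .aux ⨾ .push .data .one) (.pop .aux ⨾ .push .data .zero)))
      ⟨io, x, l ++ .bar :: y, z, c⟩ ⟨io, l.reverse ++ x, .bar :: y, z, c⟩ (1 + 4 * l.length) := by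
  induction l with
  | nil => intro io x y z c _; exact (RunIn.loop_done rfl).mono (by simp)
  | cons a l ih =>
    intro io x y z c h
    have ha := h a (by simp)
    have h' := ih (io := io) (x := a :: x) (y := y) (z := z) (c := c)
      (fun b hb => h b (by simp [hb]))
    rw [List.reverse_cons, List.append_assoc]
    rcases ha with rfl | rfl
    · exact (RunIn.loop_step rfl (.ite_false rfl (.seq (.pop _ _) (.push _ _ _))) h').mono
        (by simp; omega)
    · exact (RunIn.loop_step rfl (.ite_true rfl (.seq (.pop _ _) (.push _ _ _))) h').mono
        (by simp; omega)

theorem mem_ser (d : Dat) : ∀ a ∈ ser d, a = Letter.zero ∨ a = Letter.one := by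
  induction d with
  | nil => simp [ser]
  | node a b iha ihb =>
    intro c hc
    simp only [ser, List.mem_cons, List.mem_append] at hc
    rcases hc with rfl | hc | hc
    · exact Or.inr rfl
    · exact iha c hc
    · exact ihb c hc

theorem runIn_fromAux (d : Dat) (io x y z) :
    RunIn fromAux ⟨io, x, (ser d).reverse ++ .bar :: y, z, []⟩ ⟨io, ser d ++ x, y, z, []⟩
      (2 + 4 * (ser d).length) := by
  have := runIn_fromAux_loop (ser d).reverse (io := io) (x := x) (y := y) (z := z) (c := [])
    (fun a ha => mem_ser d a (by simpa using ha))
  rw [List.reverse_reverse] at this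
  exact (RunIn.seq this (.pop _ _)).mono (by simp)

/-- Duplicates the first tree of the data stack. -/
def dupTree : Prog :=
  toAux ⨾
  .loop .aux isBit
    (.ite .aux (isLetter .one) (.pop .aux ⨾ .push .data .one ⨾ .push .copy .one)
      (.pop .aux ⨾ .push .data .zero ⨾ .push .copy .zero)) ⨾
  .loop .copy isBit
    (.ite .copy (isLetter .one) (.pop .copy ⨾ .push .aux .one) (.pop .copy ⨾ .push .aux .zero)) ⨾
  fromAux

/-- Applied to a reversed code, this leaves the code in its original order on both the data stack
and the copy stack. Moving the copy back reverses it once more, which is the form that `fromAux`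
expects. -/
theorem runIn_dupTree_split (l : List Letter) : ∀ {io x y z c},
    (∀ a ∈ l, a = .zero ∨ a = .one) →
    RunIn (.loop .aux isBit
      (.ite .aux (isLetter .one) (.pop .aux ⨾ .push .data .one ⨾ .push .copy .one)
        (.pop .aux ⨾ .push .data .zero ⨾ .push .copy .zero)))
      ⟨io, x, l ++ .bar :: y, z, c⟩ ⟨io, l.reverse ++ x, .bar :: y, l.reverse ++ z, c⟩
      (1 + 5 * l.length) := by
  induction l with
  | nil => intro io x y z c _; exact (RunIn.loop_done rfl).mono (by simp)
  | cons a l ih =>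
    intro io x y z c h
    have ha := h a (by simp)
    have h' := ih (io := io) (x := a :: x) (y := y) (z := a :: z) (c := c)
      (fun b hb => h b (by simp [hb]))
    rw [List.reverse_cons, List.append_assoc, List.append_assoc]
    rcases ha with rfl | rfl
    · exact (RunIn.loop_step rfl (.ite_false rfl (.seq (.pop _ _) (.seq (.push _ _ _)
        (.push _ _ _)))) h').mono (by simp; omega)
    · exact (RunIn.loop_step rfl (.ite_true rfl (.seq (.pop _ _) (.seq (.push _ _ _)
        (.push _ _ _)))) h').mono (by simp; omega)

theorem runIn_dupTree_back (l : List Letter) : ∀ {io x y c},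
    (∀ a ∈ l, a = .zero ∨ a = .one) →
    RunIn (.loop .copy isBit
      (.ite .copy (isLetter .one) (.pop .copy ⨾ .push .aux .one) (.pop .copy ⨾ .push .aux .zero)))
      ⟨io, x, y, l, c⟩ ⟨io, x, l.reverse ++ y, [], c⟩ (1 + 4 * l.length) := by
  induction l with
  | nil => intro io x y c _; exact (RunIn.loop_done rfl).mono (by simp)
  | cons a l ih =>
    intro io x y c h
    have ha := h a (by simp)
    have h' := ih (io := io) (x := x) (y := a :: y) (c := c) (fun b hb => h b (by simp [hb]))
    rw [List.reverse_cons, List.append_assoc]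
    rcases ha with rfl | rfl
    · exact (RunIn.loop_step rfl (.ite_false rfl (.seq (.pop _ _) (.push _ _ _))) h').mono
        (by simp; omega)
    · exact (RunIn.loop_step rfl (.ite_true rfl (.seq (.pop _ _) (.push _ _ _))) h').mono
        (by simp; omega)

theorem runIn_dupTree (d : Dat) (io x y) :
    RunIn dupTree ⟨io, ser d ++ x, y, [], []⟩ ⟨io, ser d ++ (ser d ++ x), y, [], []⟩
      (8 + 18 * (ser d).length) := by
  have h₁ := runIn_dupTree_split (ser d).reverse (io := io) (x := x) (y := y) (z := []) (c := [])
    (fun a ha => mem_ser d a (by simpa using ha))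
  have h₂ := runIn_dupTree_back (ser d) (io := io) (x := ser d ++ x) (y := .bar :: y) (c := [])
    (mem_ser d)
  rw [List.reverse_reverse, List.append_nil] at h₁
  exact (RunIn.seq (runIn_toAux d io x y []) (.seq h₁ (.seq h₂ (runIn_fromAux d _ _ _ _)))).mono
    (by simp; omega)

/-- Pushes the letters of a word to the data stack, the last letter first. -/
def pushAll : List Letter → Prog
  | [] => skip
  | a :: l => pushAll l ⨾ .push .data a

theorem runIn_pushAll (l : List Letter) (io x y) :
    RunIn (pushAll l) ⟨io, x, y, [], []⟩ ⟨io, l ++ x, y, [], []⟩ (1 + l.length) := by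
  induction l with
  | nil => exact runIn_skip _
  | cons a l ih => exact (RunIn.seq ih (.push _ _ _)).mono (by simp)

end MultiColor

/-! ### Polynomial-time functions and their basic closure properties -/

namespace MultiColor

/-- A way to write the elements of a type as trees. -/
class Enc (α : Type) where
  enc : α → Dat

open Enc (enc)

/-- The length of the code of an element. -/
def size {α : Type} [Enc α] (a : α) : ℕ := (ser (enc a)).length

instance : Enc Unit := ⟨fun _ => .nil⟩

instance : Enc Bool := ⟨fun b => if b then .node .nil .nil else .nil⟩

instance {α β : Type} [Enc α] [Enc β] : Enc (α × β) := ⟨fun p => .node (enc p.1) (enc p.2)⟩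

/-- The code of a list. -/
def encList {α : Type} [Enc α] : List α → Dat
  | [] => .nil
  | a :: l => .node (enc a) (encList l)

instance {α : Type} [Enc α] : Enc (List α) := ⟨encList⟩

instance {α : Type} [Enc α] : Enc (Option α) := ⟨fun o => enc o.toList⟩

theorem eval_mono (q : Polynomial ℕ) {m n : ℕ} (h : m ≤ n) : q.eval m ≤ q.eval n := by
  rw [Polynomial.eval_eq_sum, Polynomial.eval_eq_sum]
  exact Finset.sum_le_sum fun i _ => Nat.mul_le_mul_left _ (Nat.pow_le_pow_left h i)

/-- The function `f` is computed, with respect to the codes of arguments and values, by a program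
that works on the first tree of the data stack and runs in polynomial time. -/
@[fun_prop]
def PolyTime {α β : Type} [Enc α] [Enc β] (f : α → β) : Prop :=
  ∃ (p : Prog) (q : Polynomial ℕ), ∀ (a : α) (io x y : List Letter),
    RunIn p ⟨io, ser (enc a) ++ x, y, [], []⟩ ⟨io, ser (enc (f a)) ++ x, y, [], []⟩
      (q.eval (size a))

section

variable {α β γ δ σ : Type} [Enc α] [Enc β] [Enc γ] [Enc δ] [Enc σ]

theorem size_pair (a : α) (b : β) : size (a, b) = size a + size b + 1 := by
  simp [size, enc, ser]

theorem size_nil : size ([] : List α) = 1 := rfl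

theorem size_cons (a : α) (l : List α) : size (a :: l) = size a + size l + 1 := by
  simp [size, enc, ser, encList]

theorem one_le_size (a : α) : 1 ≤ size a := by
  unfold size
  cases enc a <;> simp [ser]

theorem length_le_size (l : List α) : l.length ≤ size l := by
  induction l with
  | nil => simp
  | cons a l ih => rw [size_cons, List.length_cons]; omega

theorem size_mem_le {a : α} {l : List α} (h : a ∈ l) : size a ≤ size l := by
  induction l with
  | nil => simp at h
  | cons b l ih =>
    rw [size_cons]
    rcases List.mem_cons.1 h with rfl | h
    · omega
    · have := ih h; omega

theorem size_le_of_forall {l : List α} {k : ℕ} (h : ∀ a ∈ l, size a ≤ k) :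
    size l ≤ l.length * (k + 1) + 1 := by
  induction l with
  | nil => simp [size_nil]
  | cons a l ih =>
    rw [size_cons, List.length_cons, Nat.succ_mul]
    have := ih fun b hb => h b (by simp [hb])
    have := h a (by simp)
    omega

theorem size_append (l l' : List α) : size (l ++ l') + 1 = size l + size l' := by
  induction l with
  | nil => simp [size_nil]; omega
  | cons a l ih => rw [List.cons_append, size_cons, size_cons]; omega

theorem size_reverse (l : List α) : size l.reverse = size l := by
  induction l with
  | nil => rfl
  | cons a l ih =>
    have := size_append l.reverse [a]
    rw [List.reverse_cons, size_cons]
    rw [size_cons, size_nil] at this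
    omega

namespace PolyTime

/-- On an otherwise empty data stack the result is at most as long as the argument plus the number
of steps. -/
theorem size_le {f : α → β} (hf : PolyTime f) :
    ∃ q : Polynomial ℕ, ∀ a, size (f a) ≤ q.eval (size a) := by
  obtain ⟨p, q, h⟩ := hf
  refine ⟨q + Polynomial.X, fun a => ?_⟩
  obtain ⟨t, ht, hr⟩ := h a [] [] []
  have := hr.length_data_le
  simp only [List.append_nil] at this
  rw [Polynomial.eval_add, Polynomial.eval_X]
  unfold size at *
  omega

/-- A function that does not change the code is computed in polynomial time. -/
theorem of_enc {f : α → β} (h : ∀ a, enc (f a) = enc a) : PolyTime f :=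
  ⟨skip, 1, fun a io x y => by rw [h, Polynomial.eval_one]; exact runIn_skip _⟩

@[fun_prop]
theorem id : PolyTime (fun a : α => a) := of_enc fun _ => rfl

@[fun_prop]
theorem comp {g : β → γ} {f : α → β} (hg : PolyTime g) (hf : PolyTime f) :
    PolyTime fun a => g (f a) := by
  obtain ⟨r, hr⟩ := hf.size_le
  obtain ⟨p, q, h⟩ := hf
  obtain ⟨p', q', h'⟩ := hg
  refine ⟨p ⨾ p', q + q'.comp r, fun a io x y => ?_⟩
  refine (RunIn.seq (h a io x y) (h' (f a) io x y)).mono ?_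
  rw [Polynomial.eval_add, Polynomial.eval_comp]
  exact Nat.add_le_add_left (eval_mono _ (hr a)) _

@[fun_prop]
theorem const (b : β) : PolyTime fun _ : α => b := by
  refine ⟨dropTree ⨾ pushAll (ser (enc b)), 4 * Polynomial.X + Polynomial.C (3 + size b),
    fun a io x y => ?_⟩
  refine (RunIn.seq (runIn_dropTree _ _ _ _ _) (runIn_pushAll _ _ _ _)).mono ?_
  simp [size]
  omega

@[fun_prop]
theorem pair {f : α → β} {g : α → γ} (hf : PolyTime f) (hg : PolyTime g) :
    PolyTime fun a => (f a, g a) := by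
  obtain ⟨r, hr⟩ := hf.size_le
  obtain ⟨p, q, h⟩ := hf
  obtain ⟨p', q', h'⟩ := hg
  -- Since the programs leave everything below their argument untouched, `f` can run on one copy of
  -- the argument above the other. Its value is parked on the auxiliary stack while `g` runs on the
  -- second copy.
  refine ⟨dupTree ⨾ p ⨾ toAux ⨾ p' ⨾ fromAux ⨾ .push .data .one,
    18 * Polynomial.X + q + q' + 9 * r + 14, fun a io x y => ?_⟩
  refine (RunIn.seq (runIn_dupTree _ _ _ _) (.seq (h a io _ y) (.seq (runIn_toAux _ _ _ _ _)
    (.seq (h' a io x _) (.seq (runIn_fromAux _ _ _ _ _) ?_))))).mono (t := _ + (_ + (_ + (_ + (_ + 1))))) ?_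
  · convert RunIn.push _ _ _ using 1
    simp [Mem.set, Mem.get, enc, ser]
  · have := hr a
    simp [size] at *
    omega

@[fun_prop]
theorem fst' : PolyTime fun a : α × β => a.1 := by
  refine ⟨.pop .data ⨾ toAux ⨾ dropTree ⨾ fromAux, 20 * Polynomial.X + 20, fun a io x y => ?_⟩
  obtain ⟨a, b⟩ := a
  have := RunIn.seq (.pop .data ⟨io, .one :: (ser (enc a) ++ (ser (enc b) ++ x)), y, [], []⟩)
    (.seq (runIn_toAux _ _ _ _ _) (.seq (runIn_dropTree _ _ _ _ _) (runIn_fromAux _ _ _ _ _)))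
  rw [show ser (enc (a, b)) ++ x = .one :: (ser (enc a) ++ (ser (enc b) ++ x)) by simp [enc, ser]]
  refine this.mono ?_
  simp [size_pair]
  unfold size
  omega

@[fun_prop]
theorem snd' : PolyTime fun a : α × β => a.2 := by
  refine ⟨.pop .data ⨾ dropTree, 20 * Polynomial.X + 20, fun a io x y => ?_⟩
  obtain ⟨a, b⟩ := a
  have := RunIn.seq (.pop .data ⟨io, .one :: (ser (enc a) ++ (ser (enc b) ++ x)), y, [], []⟩)
    (runIn_dropTree _ _ _ _ _)
  rw [show ser (enc (a, b)) ++ x = .one :: (ser (enc a) ++ (ser (enc b) ++ x)) by simp [enc, ser]]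
  refine this.mono ?_
  simp [size_pair]
  unfold size
  omega

@[fun_prop]
theorem fst {f : α → β × γ} (hf : PolyTime f) : PolyTime fun a => (f a).1 := fst'.comp hf

@[fun_prop]
theorem snd {f : α → β × γ} (hf : PolyTime f) : PolyTime fun a => (f a).2 := snd'.comp hf

/-- Definition by cases on the first letter of the code of `f a`. -/
theorem cases_enc {f : α → β} {g : α → γ} (hf : PolyTime f) {p₀ p₁ : Prog} {q : Polynomial ℕ}
    (h₀ : ∀ a io x y, enc (f a) = .nil → RunIn p₀ ⟨io, ser (enc a) ++ x, y, [], []⟩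
      ⟨io, ser (enc (g a)) ++ x, y, [], []⟩ (q.eval (size a)))
    (h₁ : ∀ a io x y d d', enc (f a) = .node d d' →
      RunIn p₁ ⟨io, .one :: (ser d ++ (ser d' ++ (ser (enc a) ++ x))), y, [], []⟩
      ⟨io, ser (enc (g a)) ++ x, y, [], []⟩ (q.eval (size a))) :
    PolyTime g := by
  obtain ⟨p, r, h⟩ := hf
  refine ⟨dupTree ⨾ p ⨾ .ite .data (isLetter .zero) (.pop .data ⨾ p₀) p₁,
    18 * Polynomial.X + r + q + 10, fun a io x y => ?_⟩
  refine (RunIn.seq (runIn_dupTree _ _ _ _) (.seq (h a io _ y) (t' := 2 + q.eval (size a)) ?_)).mono ?_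
  · cases hd : enc (f a) with
    | nil => exact (RunIn.ite_true rfl (.seq (.pop _ _) (h₀ a io x y hd))).mono (by omega)
    | node d d' =>
      have := h₁ a io x y d d' hd
      refine (RunIn.ite_false (t := q.eval (size a)) ?_ ?_).mono (by omega)
      · simp [Mem.get, ser, isLetter]
      · simpa [ser] using this
  · simp [size]
    omega

theorem cond {f : α → Bool} {g h : α → β} (hf : PolyTime f) (hg : PolyTime g) (hh : PolyTime h) :
    PolyTime fun a => if f a then g a else h a := by
  obtain ⟨p, q, hg⟩ := hg
  obtain ⟨p', q', hh⟩ := hh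
  refine cases_enc (p₀ := p') (p₁ := dropTree ⨾ p) (q := q + q' + 20) hf ?_ ?_
  · intro a io x y hd
    have : f a = false := by
      cases hfa : f a <;> simp [hfa, enc] at hd ⊢
    rw [this]
    exact (hh a io x y).mono (by simp; omega)
  · intro a io x y d d' hd
    have : f a = true := by
      cases hfa : f a <;> simp [hfa, enc] at hd ⊢
    have hd' : Dat.node d d' = .node .nil .nil := by rw [← hd, this]; rfl
    have := runIn_dropTree (Dat.node d d') io (ser (enc a) ++ x) y []
    obtain ⟨rfl, rfl⟩ := Dat.node.inj hd'
    have hfa : f a = true := by assumption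
    rw [hfa]
    refine (RunIn.seq this (hg a io x y)).mono ?_
    simp [ser]
    omega

@[fun_prop]
theorem ite {c : α → Prop} [DecidablePred c] {g h : α → β} (hc : PolyTime fun a => decide (c a))
    (hg : PolyTime g) (hh : PolyTime h) : PolyTime fun a => if c a then g a else h a := by
  simpa using cond hc hg hh

theorem list_cases {f : α → List β} {g : α → γ} {h : (β × List β) × α → γ} (hf : PolyTime f)
    (hg : PolyTime g) (hh : PolyTime h) :
    PolyTime fun a => match f a with
      | [] => g a
      | b :: l => h ((b, l), a) := by
  obtain ⟨r, hr⟩ := hf.size_le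
  obtain ⟨p, q, hg⟩ := hg
  obtain ⟨p', q', hh⟩ := hh
  -- The stack already holds a node with subtrees `b` and `l`, followed by `a`; one more node letter
  -- in front turns this into the code of `((b, l), a)`.
  refine cases_enc (p₀ := p) (p₁ := .push .data .one ⨾ p')
    (q := q + q'.comp (Polynomial.X + r + 1) + 1) hf ?_ ?_
  · intro a io x y hd
    have : f a = [] := by
      cases hfa : f a <;> simp [hfa, enc, encList] at hd ⊢
    rw [this]
    exact (hg a io x y).mono (by simp; omega)
  · intro a io x y d d' hd
    cases hfa : f a with
    | nil => simp [hfa, enc, encList] at hd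
    | cons b l =>
      rw [hfa] at hd
      simp only [enc, encList] at hd
      obtain ⟨rfl, rfl⟩ := Dat.node.inj hd
      have h' := hh ((b, l), a) io x y
      refine (RunIn.seq (.push _ _ _) (t' := q'.eval (size ((b, l), a))) ?_).mono ?_
      · simpa [enc, ser, Mem.set, Mem.get] using h'
      · have h₁ := hr a
        rw [hfa, size_cons] at h₁
        have : size ((b, l), a) ≤ size a + r.eval (size a) + 1 := by
          rw [size_pair, size_pair]; omega
        have := eval_mono q' this
        simp [Polynomial.eval_comp]
        omega

@[fun_prop]
theorem cons {f : α → β} {g : α → List β} (hf : PolyTime f) (hg : PolyTime g) :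
    PolyTime fun a => f a :: g a :=
  (of_enc (f := fun p : β × List β => p.1 :: p.2) fun _ => rfl).comp (hf.pair hg)

/-- A fold is computed in polynomial time if all intermediate results have polynomial size. -/
theorem foldl {l : α → List β} {g : α → σ} {h : α × σ × β → σ} (hl : PolyTime l)
    (hg : PolyTime g) (hh : PolyTime h) (r : Polynomial ℕ)
    (hr : ∀ a l', l' <+: l a → size (l'.foldl (fun s b => h (a, s, b)) (g a)) ≤ r.eval (size a)) :
    PolyTime fun a => (l a).foldl (fun s b => h (a, s, b)) (g a) := by
  have hbody : PolyTime fun p : (β × List β) × α × σ => (p.1.2, p.2.1, h (p.2.1, p.2.2, p.1.1)) := by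
    fun_prop
  have hstart : PolyTime fun a => (l a, a, g a) := by fun_prop
  obtain ⟨rl, hrl⟩ := hl.size_le
  obtain ⟨pb, qb, hb⟩ := hbody
  obtain ⟨ps, qs, hs⟩ := hstart
  obtain ⟨p₂, q₂, h₂⟩ := snd' (α := α) (β := σ)
  -- The stack holds the remaining list above `(a, s)`. While the list is nonempty, pushing a node
  -- letter produces the code of the argument of `hbody`, and popping the node letter of the result
  -- restores the shape. The bound `k` covers one run of the body, and the summand 3 covers test,
  -- push and pop.
  have hloop : ∀ a io x y k, ∀ l' s, size l' ≤ rl.eval (size a) →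
      (∀ l'', l'' <+: l' → size (l''.foldl (fun s b => h (a, s, b)) s) ≤ r.eval (size a)) →
      qb.eval (rl.eval (size a) + size a + r.eval (size a) + 2) ≤ k →
      RunIn (.loop .data (isLetter .one) (.push .data .one ⨾ pb ⨾ .pop .data))
        ⟨io, ser (enc l') ++ (ser (enc (a, s)) ++ x), y, [], []⟩
        ⟨io, .zero :: (ser (enc (a, l'.foldl (fun s b => h (a, s, b)) s)) ++ x), y, [], []⟩
        (l'.length * (k + 3) + 1) := by
    intro a io x y k l'
    induction l' with
    | nil =>
      intro s _ _ _
      exact (RunIn.loop_done rfl).mono (by simp)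
    | cons b l' ih =>
      intro s hl' hs' hk
      rw [size_cons] at hl'
      have h₁ := ih (h (a, s, b)) (by omega)
        (fun l'' hl'' => hs' (b :: l'') (List.cons_prefix_cons.2 ⟨rfl, hl''⟩)) hk
      have h₀ := hb ((b, l'), (a, s)) io x y
      have hsz : size (((b, l'), (a, s)) : (β × List β) × α × σ) ≤
          rl.eval (size a) + size a + r.eval (size a) + 2 := by
        have := hs' [] List.nil_prefix
        rw [List.foldl_nil] at this
        rw [size_pair, size_pair, size_pair]
        omega
      have hqb := (eval_mono qb hsz).trans hk
      refine (RunIn.loop_step (t := 1 + (qb.eval (size ((b, l'), (a, s))) + 1)) ?_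
        (.seq (.push _ _ _) (.seq (s' := ⟨io, .one :: (ser (enc l') ++ (ser (enc (a, h (a, s, b))) ++ x)), y, [], []⟩)
          ?_ (.pop _ _))) h₁).mono ?_
      · simp [enc, encList, ser, Mem.get, isLetter]
      · simpa [enc, encList, ser, Mem.get, Mem.set] using h₀
      · rw [List.length_cons, Nat.succ_mul]
        omega
  refine ⟨ps ⨾ .pop .data ⨾ .loop .data (isLetter .one) (.push .data .one ⨾ pb ⨾ .pop .data) ⨾
    .pop .data ⨾ p₂, qs + rl * (qb.comp (rl + Polynomial.X + r + 2) + 3) +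
      q₂.comp (Polynomial.X + r + 1) + 3, fun a io x y => ?_⟩
  refine (RunIn.seq (hs a io x y) (.seq (s' := ⟨io, ser (enc (l a)) ++ (ser (enc (a, g a)) ++ x), y, [], []⟩)
    (t := 1) ?_ (.seq (hloop a io x y _ (l a) (g a) (hrl a) (hr a) le_rfl)
      (.seq (.pop _ _) (h₂ (a, (l a).foldl (fun s b => h (a, s, b)) (g a)) io x y))))).mono ?_
  · convert RunIn.pop .data _ using 1
    simp [enc, ser, Mem.set, Mem.get]
  · have h₁ := eval_mono q₂ (show size (a, (l a).foldl (fun s b => h (a, s, b)) (g a)) ≤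
      size a + r.eval (size a) + 1 by
        have := hr a _ List.prefix_rfl
        rw [size_pair]; omega)
    have h₂ := (length_le_size (l a)).trans (hrl a)
    have h₃ := Nat.mul_le_mul_right
      (qb.eval (rl.eval (size a) + size a + r.eval (size a) + 2) + 3) h₂
    simp [Polynomial.eval_comp]
    omega

/-- A fold is computed in polynomial time if the size of the state is controlled by a quantity
that no step increases by more than a polynomial in the size of the other arguments. -/
theorem foldl_of_measure {l : α → List β} {g : α → σ} {h : α × σ × β → σ} (hl : PolyTime l)
    (hg : PolyTime g) (hh : PolyTime h) (μ : σ → ℕ) (r rμ rg : Polynomial ℕ)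
    (hμ : ∀ s, size s ≤ rμ.eval (μ s)) (hrg : ∀ a, μ (g a) ≤ rg.eval (size a))
    (hr : ∀ a s b, μ (h (a, s, b)) ≤ μ s + r.eval (size a + size b)) :
    PolyTime fun a => (l a).foldl (fun s b => h (a, s, b)) (g a) := by
  obtain ⟨rl, hrl⟩ := hl.size_le
  refine foldl hl hg hh (rμ.comp (rg + rl * r.comp (Polynomial.X + rl))) fun a l' hl' => ?_
  have key : ∀ l' : List β, ∀ s, (∀ b ∈ l', b ∈ l a) →
      μ (l'.foldl (fun s b => h (a, s, b)) s) ≤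
        μ s + l'.length * r.eval (size a + rl.eval (size a)) := by
    intro l'
    induction l' with
    | nil => intro s _; simp
    | cons b l' ih =>
      intro s hb
      have h₁ := ih (h (a, s, b)) fun b hb' => hb b (by simp [hb'])
      have h₂ := hr a s b
      have h₃ := eval_mono r (Nat.add_le_add_left ((size_mem_le (hb b (by simp))).trans (hrl a))
        (size a))
      rw [List.foldl_cons, List.length_cons, Nat.succ_mul]
      omega
  refine (hμ _).trans ?_
  rw [Polynomial.eval_comp]
  refine eval_mono rμ ((key l' (g a) fun b hb => hl'.subset hb).trans ?_)
  have h₁ := hl'.length_le.trans ((length_le_size (l a)).trans (hrl a))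
  have h₂ := Nat.mul_le_mul_right (r.eval (size a + rl.eval (size a))) h₁
  have h₃ := hrg a
  simp [Polynomial.eval_comp]
  omega

/-- A fold is computed in polynomial time if no step enlarges the state by more than a polynomial
in the size of the other arguments. -/
theorem foldl_of_size_le {l : α → List β} {g : α → σ} {h : α × σ × β → σ} (hl : PolyTime l)
    (hg : PolyTime g) (hh : PolyTime h) (r : Polynomial ℕ)
    (hr : ∀ a s b, size (h (a, s, b)) ≤ size s + r.eval (size a + size b)) :
    PolyTime fun a => (l a).foldl (fun s b => h (a, s, b)) (g a) := by
  obtain ⟨rg, hrg⟩ := hg.size_le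
  exact foldl_of_measure hl hg hh size r Polynomial.X rg (fun s => by simp) hrg hr

/-- If two functions have the same codes of values, then one is computed in polynomial time if the
other is. -/
theorem congr_enc {f : α → β} {g : α → γ} (hg : PolyTime g) (h : ∀ a, enc (f a) = enc (g a)) :
    PolyTime f := by
  obtain ⟨p, q, hp⟩ := hg
  exact ⟨p, q, fun a io x y => by rw [h]; exact hp a io x y⟩

end PolyTime

end

end MultiColor

/-! ### Booleans, lists, options and letters -/

namespace MultiColor
open Enc (enc)

section

variable {α β γ δ σ : Type} [Enc α] [Enc β] [Enc γ] [Enc δ] [Enc σ]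

namespace PolyTime

@[fun_prop]
theorem not {f : α → Bool} (hf : PolyTime f) : PolyTime fun a => !f a := by
  refine (cond hf (const false) (const true)).congr_enc fun a => ?_
  cases f a <;> rfl

@[fun_prop]
theorem and {f g : α → Bool} (hf : PolyTime f) (hg : PolyTime g) :
    PolyTime fun a => f a && g a := by
  refine (cond hf hg (const false)).congr_enc fun a => ?_
  cases f a <;> rfl

@[fun_prop]
theorem or {f g : α → Bool} (hf : PolyTime f) (hg : PolyTime g) :
    PolyTime fun a => f a || g a := by
  refine (cond hf (const true) hg).congr_enc fun a => ?_
  cases f a <;> rfl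

@[fun_prop]
theorem beq {f g : α → Bool} (hf : PolyTime f) (hg : PolyTime g) :
    PolyTime fun a => f a == g a := by
  refine (cond hf hg hg.not).congr_enc fun a => ?_
  cases f a <;> cases g a <;> rfl

@[fun_prop]
theorem decide_eq_true {f : α → Bool} (hf : PolyTime f) : PolyTime fun a => decide (f a = true) := by
  simpa using hf

@[fun_prop]
theorem decide_and {c d : α → Prop} [DecidablePred c] [DecidablePred d]
    (hc : PolyTime fun a => decide (c a)) (hd : PolyTime fun a => decide (d a)) :
    PolyTime fun a => decide (c a ∧ d a) := by
  simpa using hc.and hd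

@[fun_prop]
theorem decide_not {c : α → Prop} [DecidablePred c] (hc : PolyTime fun a => decide (c a)) :
    PolyTime fun a => decide (¬ c a) := by
  simpa using hc.not

@[fun_prop]
theorem isEmpty {f : α → List β} (hf : PolyTime f) : PolyTime fun a => (f a).isEmpty := by
  refine (list_cases hf (const true) (h := fun _ => false) (const false)).congr_enc fun a => ?_
  cases f a <;> rfl

@[fun_prop]
theorem headD {f : α → List β} {g : α → β} (hf : PolyTime f) (hg : PolyTime g) :
    PolyTime fun a => (f a).headD (g a) := by
  refine (list_cases hf hg (h := fun p => p.1.1) (by fun_prop)).congr_enc fun a => ?_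
  cases f a <;> rfl

@[fun_prop]
theorem tail {f : α → List β} (hf : PolyTime f) : PolyTime fun a => (f a).tail := by
  refine (list_cases hf (const []) (h := fun p => p.1.2) (by fun_prop)).congr_enc fun a => ?_
  cases f a <;> rfl

@[fun_prop]
theorem reverse {f : α → List β} (hf : PolyTime f) : PolyTime fun a => (f a).reverse := by
  have : PolyTime fun a => (f a).foldl (fun s b => b :: s) [] := by
    refine foldl_of_size_le (h := fun p : α × List β × β => p.2.2 :: p.2.1) hf (const _) (by fun_prop) (Polynomial.X + 1) fun a s b => ?_
    simp [size_cons]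
    omega
  refine this.congr_enc fun a => ?_
  simp

@[fun_prop]
theorem append {f g : α → List β} (hf : PolyTime f) (hg : PolyTime g) :
    PolyTime fun a => f a ++ g a := by
  have : PolyTime fun a => (f a).reverse.foldl (fun s b => b :: s) (g a) := by
    refine foldl_of_size_le (h := fun p : α × List β × β => p.2.2 :: p.2.1) hf.reverse hg (by fun_prop) (Polynomial.X + 1) fun a s b => ?_
    simp [size_cons]
    omega
  refine this.congr_enc fun a => ?_
  simp

theorem foldr_of_measure {l : α → List β} {g : α → σ} {h : α → β → σ → σ} (hl : PolyTime l)
    (hg : PolyTime g) (hh : PolyTime fun p : α × β × σ => h p.1 p.2.1 p.2.2) (μ : σ → ℕ)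
    (r rμ rg : Polynomial ℕ)
    (hμ : ∀ s, size s ≤ rμ.eval (μ s)) (hrg : ∀ a, μ (g a) ≤ rg.eval (size a))
    (hr : ∀ a b s, μ (h a b s) ≤ μ s + r.eval (size a + size b)) :
    PolyTime fun a => (l a).foldr (h a) (g a) := by
  have := foldl_of_measure (h := fun p => h p.1 p.2.2 p.2.1) hl.reverse hg
    (hh.comp (f := fun p : α × σ × β => (p.1, p.2.2, p.2.1)) (by fun_prop)) μ r rμ rg hμ hrg
    fun a s b => hr a b s
  simpa using this

theorem foldr_of_size_le {l : α → List β} {g : α → σ} {h : α → β → σ → σ} (hl : PolyTime l)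
    (hg : PolyTime g) (hh : PolyTime fun p : α × β × σ => h p.1 p.2.1 p.2.2) (r : Polynomial ℕ)
    (hr : ∀ a b s, size (h a b s) ≤ size s + r.eval (size a + size b)) :
    PolyTime fun a => (l a).foldr (h a) (g a) := by
  obtain ⟨rg, hrg⟩ := hg.size_le
  exact foldr_of_measure hl hg hh size r Polynomial.X rg (fun s => by simp) hrg hr

theorem map {l : α → List β} {h : α → β → γ} (hl : PolyTime l)
    (hh : PolyTime fun p : α × β => h p.1 p.2) : PolyTime fun a => (l a).map (h a) := by
  obtain ⟨r, hr⟩ := hh.size_le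
  have : PolyTime fun a => (l a).foldr (fun b s => h a b :: s) [] := by
    refine foldr_of_size_le hl (const _) ?_ (r.comp (Polynomial.X + 1) + 1) fun a b s => ?_
    · exact (hh.comp (f := fun p : α × β × List γ => (p.1, p.2.1)) (by fun_prop)).cons
        (by fun_prop)
    · have : size (h a b) ≤ _ := hr (a, b)
      rw [size_pair] at this
      simp [size_cons, Polynomial.eval_comp]
      omega
  refine this.congr_enc fun a => ?_
  simp

@[fun_prop]
theorem zip {f : α → List β} {g : α → List γ} (hf : PolyTime f) (hg : PolyTime g) :
    PolyTime fun a => (f a).zip (g a) := by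
  -- The state consists of what is left of the second list and the pairs formed so far, in reverse
  -- order.
  let h : α × (List γ × List (β × γ)) × β → List γ × List (β × γ) := fun p =>
    match p.2.1.1 with
    | [] => ([], p.2.1.2)
    | c :: l => (l, (p.2.2, c) :: p.2.1.2)
  have hh : PolyTime h := list_cases (f := fun p : α × (List γ × List (β × γ)) × β => p.2.1.1)
    (g := fun p => ([], p.2.1.2)) (h := fun q => (q.1.2, (q.2.2.2, q.1.1) :: q.2.2.1.2))
    (by fun_prop) (by fun_prop) (by fun_prop)
  have : PolyTime fun a => (f a).foldl (fun s b => h (a, s, b)) (g a, []) := by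
    refine foldl_of_size_le hf (by fun_prop) hh (Polynomial.X + 2) fun a s b => ?_
    obtain ⟨s, t⟩ := s
    cases s <;> simp [h, size_cons, size_pair, size_nil] <;> omega
  refine (show PolyTime fun a => ((f a).foldl (fun s b => h (a, s, b)) (g a, [])).2.reverse by
    fun_prop).congr_enc fun a => ?_
  have key : ∀ (l : List β) (l' : List γ) (t : List (β × γ)),
      (l.foldl (fun s b => h (a, s, b)) (l', t)).2 = (l.zip l').reverse ++ t := by
    intro l
    induction l with
    | nil => simp
    | cons b l ih =>
      intro l' t
      cases l' with
      | nil =>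
        rw [List.foldl_cons]
        have := ih [] t
        simpa [h] using this
      | cons c l' =>
        rw [List.foldl_cons]
        have := ih l' ((b, c) :: t)
        simpa [h] using this
  simp [key]

theorem zipWith {f : α → List β} {g : α → List γ} {h : α → β → γ → δ} (hf : PolyTime f)
    (hg : PolyTime g) (hh : PolyTime fun p : α × β × γ => h p.1 p.2.1 p.2.2) :
    PolyTime fun a => List.zipWith (h a) (f a) (g a) := by
  refine (map (h := fun a (p : β × γ) => h a p.1 p.2) (hf.zip hg)
    (hh.comp (f := fun p : α × β × γ => (p.1, p.2.1, p.2.2)) (by fun_prop))).congr_enc fun a => ?_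
  simp [List.zip, List.map_zipWith]

@[fun_prop]
theorem flatten {f : α → List (List β)} (hf : PolyTime f) : PolyTime fun a => (f a).flatten := by
  have : PolyTime fun a => (f a).foldr (fun b s => b ++ s) [] := by
    refine foldr_of_size_le hf (const _) (by fun_prop) Polynomial.X fun a b s => ?_
    have := size_append b s
    simp
    omega
  refine this.congr_enc fun a => ?_
  congr 1
  induction f a with
  | nil => rfl
  | cons b l ih => simp [ih]

theorem flatMap {l : α → List β} {h : α → β → List γ} (hl : PolyTime l)
    (hh : PolyTime fun p : α × β => h p.1 p.2) : PolyTime fun a => (l a).flatMap (h a) := by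
  simpa [List.flatMap_def] using (map hl hh).flatten

@[fun_prop]
theorem toList {f : α → Option β} (hf : PolyTime f) : PolyTime fun a => (f a).toList :=
  hf.congr_enc fun _ => rfl

@[fun_prop]
theorem some {f : α → β} (hf : PolyTime f) : PolyTime fun a => some (f a) :=
  (hf.cons (const [])).congr_enc fun _ => rfl

theorem option_cases {f : α → Option β} {g : α → γ} {h : α → β → γ} (hf : PolyTime f)
    (hg : PolyTime g) (hh : PolyTime fun p : α × β => h p.1 p.2) :
    PolyTime fun a => match f a with
      | none => g a
      | .some b => h a b := by
  refine (list_cases hf.toList hg (hh.comp (f := fun p : (β × List β) × α => (p.2, p.1.1))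
    (by fun_prop))).congr_enc fun a => ?_
  cases f a <;> rfl

end PolyTime

end

/-- The position of a letter in the alphabet. -/
def Letter.index : Letter → ℕ
  | .zero => 0
  | .one => 1
  | .minus => 2
  | .slash => 3
  | .comma => 4
  | .semicolon => 5
  | .bar => 6

/-- The letter at a position. -/
def Letter.ofIndex : ℕ → Letter
  | 0 => .zero
  | 1 => .one
  | 2 => .minus
  | 3 => .slash
  | 4 => .comma
  | 5 => .semicolon
  | _ => .bar

theorem Letter.ofIndex_index (a : Letter) : Letter.ofIndex a.index = a := by cases a <;> rfl

/-- The unary code reduces case distinctions on letters to case distinctions on lists and can be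
handled directly by the reading and writing programs. -/
instance : Enc Letter := ⟨fun a => enc (List.replicate a.index ())⟩

/-- Every function on the alphabet is computed in polynomial time. -/
theorem PolyTime.of_letter {α β : Type} [Enc α] [Enc β] (f : Letter → β) {g : α → Letter}
    (hg : PolyTime g) : PolyTime fun a => f (g a) := by
  -- A function of a number truncated at `k` is a nested case distinction of depth `k`. Truncation
  -- at 7 loses nothing, as the positions are at most 6.
  have key : ∀ k, ∀ F : ℕ → β, PolyTime fun l : List Unit => F (min l.length k) := by
    intro k
    induction k with
    | zero => intro F; simpa using PolyTime.const (F 0)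
    | succ k ih =>
      intro F
      refine (list_cases (f := fun l : List Unit => l) id (const (F 0))
        ((ih fun i => F (i + 1)).comp (f := fun p : (Unit × List Unit) × List Unit => p.1.2)
        (by fun_prop))).congr_enc fun l => ?_
      cases l <;> simp
  have hg' : PolyTime fun a => List.replicate (g a).index () := hg.congr_enc fun _ => rfl
  refine ((key 7 fun i => f (Letter.ofIndex i)).comp hg').congr_enc fun a => ?_
  have : (g a).index ≤ 7 := by cases g a <;> simp [Letter.index]
  rw [List.length_replicate, min_eq_left this, Letter.ofIndex_index]

@[fun_prop]
theorem PolyTime.decide_letter {α : Type} [Enc α] {g : α → Letter} (hg : PolyTime g) (b : Letter) :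
    PolyTime fun a => decide (g a = b) :=
  PolyTime.of_letter (fun c => decide (c = b)) hg

end MultiColor

/-! ### Binary arithmetic of natural numbers -/

namespace MultiColor
open Enc (enc)

instance : Enc ℕ := ⟨fun n => enc n.bits⟩

/-- The digit 0 must not be put in front of the empty word: codes have no superfluous leading zeros.
-/
theorem bits_bit (b : Bool) (n : ℕ) :
    (Nat.bit b n).bits = if (!b && decide (n = 0)) = true then [] else b :: n.bits := by
  split_ifs with h
  · simp only [Bool.and_eq_true, Bool.not_eq_true', decide_eq_true_eq] at h
    obtain ⟨rfl, rfl⟩ := h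
    simp
  · refine Nat.bits_append_bit n b fun hn => ?_
    simpa [hn] using h

theorem size_bool_le (b : Bool) : size b ≤ 3 := by cases b <;> simp [size, enc, ser]

theorem natSize_le_size (n : ℕ) : n.size ≤ size n := by
  rw [← Nat.size_eq_bits_len]
  exact length_le_size n.bits

theorem size_nat_le (n : ℕ) : size n ≤ 4 * n.size + 1 := by
  have : size n.bits ≤ n.bits.length * 4 + 1 := size_le_of_forall fun b _ => size_bool_le b
  rw [Nat.size_eq_bits_len] at this
  have h : size n = size n.bits := rfl
  omega

/-- The size is not itself monotone, since the digit 1 has a longer code than the digit 0 (the code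
of 7 is longer than that of 8). It agrees with the number of digits up to a constant factor. -/
theorem size_nat_mono {m n : ℕ} (h : m ≤ n) : size m ≤ 4 * size n + 1 := by
  have h₁ := size_nat_le m
  have h₂ := Nat.size_le_size h
  have h₃ := natSize_le_size n
  omega

theorem size_div2_le (n : ℕ) : size n.div2 ≤ size n := by
  change size n.div2.bits ≤ size n.bits
  rw [Nat.div2_bits_eq_tail]
  cases n.bits with
  | nil => simp
  | cons b l => rw [size_cons, List.tail_cons]; omega

theorem size_bit_le (b : Bool) (n : ℕ) : size (Nat.bit b n) ≤ size n + 4 := by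
  change size (Nat.bit b n).bits ≤ size n.bits + 4
  rw [bits_bit]
  have := size_bool_le b
  split_ifs
  · simp [size_nil]
  · rw [size_cons]; omega

theorem natSize_add_le (m n : ℕ) : (m + n).size ≤ m.size + n.size + 1 := by
  rw [Nat.size_le]
  have h₁ := Nat.lt_size_self m
  have h₂ := Nat.lt_size_self n
  have h₃ := Nat.pow_le_pow_right (n := 2) (by norm_num) (show m.size ≤ m.size + n.size by omega)
  have h₄ := Nat.pow_le_pow_right (n := 2) (by norm_num) (show n.size ≤ m.size + n.size by omega)
  rw [pow_succ]
  omega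

theorem natSize_mul_le (m n : ℕ) : (m * n).size ≤ m.size + n.size := by
  rw [Nat.size_le, pow_add]
  exact Nat.mul_lt_mul'' (Nat.lt_size_self m) (Nat.lt_size_self n)

/-- Splits off the last binary digits of two numbers. -/
def digitStep (s : ℕ × ℕ × List (Bool × Bool)) : ℕ × ℕ × List (Bool × Bool) :=
  (s.1.div2, s.2.1.div2, (s.1.bodd, s.2.1.bodd) :: s.2.2)

/-- The pairs of the binary digits of two numbers, most significant digits first. -/
def digitPairs (a b : ℕ) : List (Bool × Bool) :=
  ((a.bits ++ b.bits).foldl (fun s _ => digitStep s) (a, b, [])).2.2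

/-- `R a b` is the state belonging to leading parts `a` and `b`, and `h` says that one step appends
a digit to each. The concatenated digit lists in `digitPairs` only serve as a counter long enough
for both numbers; the padding zeros are harmless because `h` makes `R 0 0` a fixed point for them.
-/
theorem foldl_digitPairs {σ : Type} (G : σ → Bool × Bool → σ) (R : ℕ → ℕ → σ)
    (h : ∀ a b x y, G (R a b) (x, y) = R (Nat.bit x a) (Nat.bit y b)) (a b : ℕ) :
    (digitPairs a b).foldl G (R 0 0) = R a b := by
  -- The digits split off so far are stacked in `o`, so the last ones split off, which are the most
  -- significant, are consumed first.
  have key : ∀ (t : List Bool) (a b : ℕ) (o : List (Bool × Bool)),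
      a < 2 ^ t.length → b < 2 ^ t.length →
      (t.foldl (fun s _ => digitStep s) (a, b, o)).2.2.foldl G (R 0 0) = o.foldl G (R a b) := by
    intro t
    induction t with
    | nil =>
      intro a b o ha hb
      simp only [List.length_nil, pow_zero, Nat.lt_one_iff] at ha hb
      subst ha hb
      rfl
    | cons x t ih =>
      intro a b o ha hb
      rw [List.length_cons, pow_succ] at ha hb
      rw [List.foldl_cons, digitStep, ih]
      · rw [List.foldl_cons, h, Nat.bit_bodd_div2, Nat.bit_bodd_div2]
      · simp only [Nat.div2_val]; omega
      · simp only [Nat.div2_val]; omega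
  refine key _ a b [] ?_ ?_
  · refine (Nat.lt_size_self a).trans_le (Nat.pow_le_pow_right (by norm_num) ?_)
    rw [List.length_append, Nat.size_eq_bits_len]
    omega
  · refine (Nat.lt_size_self b).trans_le (Nat.pow_le_pow_right (by norm_num) ?_)
    rw [List.length_append, Nat.size_eq_bits_len b]
    omega

/-- One digit of the sum of two numbers; the state is the sum of the leading parts together with
its successor. -/
def addStep (s : ℕ × ℕ) (d : Bool × Bool) : ℕ × ℕ :=
  if (d.1 && d.2) = true then (Nat.bit false s.2, Nat.bit true s.2)
  else if (d.1 || d.2) = true then (Nat.bit true s.1, Nat.bit false s.2)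
  else (Nat.bit false s.1, Nat.bit true s.1)

/-- Working from the leading digits, the carry out of the lower ones is still unknown, but it can
only be 0 or 1; hence both possible sums are kept. -/
theorem foldl_addStep (a b : ℕ) : (digitPairs a b).foldl addStep (0, 1) = (a + b, a + b + 1) := by
  refine foldl_digitPairs addStep (fun a b => (a + b, a + b + 1)) (fun a b x y => ?_) a b
  cases x <;> cases y <;> simp [addStep, Nat.bit_val] <;> omega

/-- The predecessor, digit by digit; the state is the leading part together with its
predecessor. -/
def predStep (b : Bool) (s : ℕ × ℕ) : ℕ × ℕ :=
  (Nat.bit b s.1, if b = true then Nat.bit false s.1 else if s.1 = 0 then 0 else Nat.bit true s.2)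

theorem foldr_predStep (n : ℕ) : n.bits.foldr predStep (0, 0) = (n, n - 1) := by
  induction n using Nat.binaryRec' with
  | zero => simp
  | bit b n h ih =>
    rw [Nat.bits_append_bit n b h, List.foldr_cons, ih]
    cases b
    · have : n ≠ 0 := fun hn => by simpa using h hn
      simp [predStep, Nat.bit_val, this]
      omega
    · simp [predStep, Nat.bit_val]

/-- One digit of the difference of two numbers; the state tells whether the first leading part is
smaller, and otherwise contains the difference of the leading parts. -/
def subStep (s : Bool × ℕ) (d : Bool × Bool) : Bool × ℕ :=
  if s.1 = true then (true, 0)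
  else if (d.1 == d.2) = true then (false, Nat.bit false s.2)
  else if d.1 = true then (false, Nat.bit true s.2)
  else if s.2 = 0 then (true, 0)
  else (false, Nat.bit true (s.2 - 1))

/-- Once the leading part of `a` is smaller, it remains smaller whatever digits follow. Otherwise
the difference becomes twice the old one plus the difference of the digits, and this is negative
only if the old difference is 0 and the digits are 0 and 1. -/
theorem foldl_subStep (a b : ℕ) :
    (digitPairs a b).foldl subStep (false, 0) = (decide (a < b), a - b) := by
  refine foldl_digitPairs subStep (fun a b => (decide (a < b), a - b)) (fun a b x y => ?_) a b
  rcases lt_trichotomy a b with h | rfl | h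
  · cases x <;> cases y <;> simp [subStep, Nat.bit_val, h] <;> omega
  · cases x <;> cases y <;> simp [subStep, Nat.bit_val]
  · have h' : ¬ a < b := by omega
    have h'' : ¬ a ≤ b := by omega
    cases x <;> cases y <;> simp [subStep, Nat.bit_val, h', h'', Nat.sub_eq_zero_iff_le] <;> omega

/-- Horner's scheme: the fold meets the most significant digit first. -/
theorem foldr_mul (a b : ℕ) :
    a.bits.foldr (fun x s => Nat.bit false s + if x = true then b else 0) 0 = a * b := by
  induction a using Nat.binaryRec' with
  | zero => simp
  | bit x n h ih =>
    rw [Nat.bits_append_bit n x h, List.foldr_cons, ih]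
    cases x <;> simp [Nat.bit_val] <;> ring

/-- One digit of a long division by `d`; the state contains quotient and remainder. -/
def divStep (d : ℕ) (x : Bool) (s : ℕ × ℕ) : ℕ × ℕ :=
  if Nat.bit x s.2 < d then (Nat.bit false s.1, Nat.bit x s.2)
  else (Nat.bit true s.1, Nat.bit x s.2 - d)

/-- Quotient and remainder are determined by `a = q * d + r` and `r < d`. Appending a digit to the
remainder gives a number below `2 * d`, so a single subtraction restores the invariant. -/
theorem foldr_divStep (a : ℕ) {d : ℕ} (hd : 0 < d) :
    a.bits.foldr (divStep d) (0, 0) = (a / d, a % d) := by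
  have key : ∀ q r, a = q * d + r → r < d → (q, r) = (a / d, a % d) := by
    rintro q r rfl hr
    rw [Nat.add_comm, Nat.add_mul_div_right _ _ hd, Nat.div_eq_of_lt hr, Nat.add_mul_mod_self_right,
      Nat.mod_eq_of_lt hr, Nat.zero_add]
  suffices h : a = (a.bits.foldr (divStep d) (0, 0)).1 * d + (a.bits.foldr (divStep d) (0, 0)).2 ∧
      (a.bits.foldr (divStep d) (0, 0)).2 < d from key _ _ h.1 h.2
  clear key
  induction a using Nat.binaryRec' with
  | zero => simpa using hd
  | bit x n h ih =>
    rw [Nat.bits_append_bit n x h, List.foldr_cons]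
    obtain ⟨h₁, h₂⟩ := ih
    generalize n.bits.foldr (divStep d) (0, 0) = s at *
    obtain ⟨q, r⟩ := s
    simp only at h₁ h₂
    unfold divStep
    cases x <;> split_ifs with hlt <;> simp only [Nat.bit_val, Bool.toNat_false, Bool.toNat_true] at * <;>
      refine ⟨?_, by omega⟩ <;> rw [h₁] <;> ring_nf <;> ring_nf at hlt <;> omega

namespace PolyTime

variable {α β : Type} [Enc α] [Enc β]

@[fun_prop]
theorem bits {f : α → ℕ} (hf : PolyTime f) : PolyTime fun a => (f a).bits :=
  hf.congr_enc fun _ => rfl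

@[fun_prop]
theorem bodd {f : α → ℕ} (hf : PolyTime f) : PolyTime fun a => (f a).bodd := by
  refine (hf.bits.headD (const false)).congr_enc fun a => ?_
  rw [Nat.bodd_eq_bits_head]
  cases (f a).bits <;> rfl

@[fun_prop]
theorem div2 {f : α → ℕ} (hf : PolyTime f) : PolyTime fun a => (f a).div2 := by
  refine hf.bits.tail.congr_enc fun a => ?_
  rw [← Nat.div2_bits_eq_tail]
  rfl

@[fun_prop]
theorem decide_eq_zero {f : α → ℕ} (hf : PolyTime f) : PolyTime fun a => decide (f a = 0) := by
  refine hf.bits.isEmpty.congr_enc fun a => congrArg enc ?_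
  by_cases h : f a = 0
  · simp [h]
  · have : (f a).bits ≠ [] := fun h' => h (by
      have := Nat.size_eq_bits_len (f a)
      rw [h', List.length_nil] at this
      exact Nat.size_eq_zero.1 this.symm)
    simp [h, this]

@[fun_prop]
theorem bit {f : α → Bool} {g : α → ℕ} (hf : PolyTime f) (hg : PolyTime g) :
    PolyTime fun a => Nat.bit (f a) (g a) := by
  refine (show PolyTime fun a => if (!f a && decide (g a = 0)) = true then [] else
    f a :: (g a).bits by fun_prop).congr_enc fun a => ?_
  rw [← bits_bit]
  rfl

@[fun_prop]
theorem digitPairs {f g : α → ℕ} (hf : PolyTime f) (hg : PolyTime g) :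
    PolyTime fun a => digitPairs (f a) (g a) := by
  have : PolyTime fun a => ((f a).bits ++ (g a).bits).foldl (fun s _ => digitStep s)
      (f a, g a, []) := by
    refine foldl_of_size_le (h := fun p : α × (ℕ × ℕ × List (Bool × Bool)) × Bool =>
      digitStep p.2.1) (by fun_prop) (by fun_prop) (by unfold digitStep; fun_prop) 8
      fun a s b => ?_
    obtain ⟨x, y, o⟩ := s
    have h₁ := size_div2_le x
    have h₂ := size_div2_le y
    have h₃ := size_bool_le x.bodd
    have h₄ := size_bool_le y.bodd
    simp [digitStep, size_pair, size_cons]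
    omega
  exact this.snd.snd

@[fun_prop]
theorem add {f g : α → ℕ} (hf : PolyTime f) (hg : PolyTime g) : PolyTime fun a => f a + g a := by
  have : PolyTime fun a => (MultiColor.digitPairs (f a) (g a)).foldl addStep (0, 1) := by
    refine foldl_of_measure (h := fun p : α × (ℕ × ℕ) × (Bool × Bool) => addStep p.2.1 p.2.2)
      (by fun_prop) (by fun_prop) (by unfold addStep; fun_prop)
      -- Both new components may come from the same old one, so the total size could double; the
      -- maximum grows only by a constant.
      (fun s => max (size s.1) (size s.2)) 4 (2 * Polynomial.X + 1) 10 (fun s => ?_)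
      (fun a => ?_) fun a s b => ?_
    · obtain ⟨x, y⟩ := s
      simp [size_pair]
      omega
    · simp [size, enc, encList, ser]
    · obtain ⟨x, y⟩ := s
      have h₁ := size_bit_le true x
      have h₂ := size_bit_le false x
      have h₃ := size_bit_le true y
      have h₄ := size_bit_le false y
      simp only [addStep, Polynomial.eval_ofNat]
      split_ifs <;> simp only <;> omega
  refine this.fst.congr_enc fun a => ?_
  rw [foldl_addStep]

@[fun_prop]
theorem pred {f : α → ℕ} (hf : PolyTime f) : PolyTime fun a => f a - 1 := by
  have : PolyTime fun a => (f a).bits.foldr predStep (0, 0) := by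
    refine foldr_of_measure (h := fun _ => predStep) (by fun_prop) (by fun_prop)
      (by unfold predStep; fun_prop)
      (fun s => max (size s.1) (size s.2)) 4 (2 * Polynomial.X + 1) 10 (fun s => ?_)
      (fun a => ?_) fun a b s => ?_
    · obtain ⟨x, y⟩ := s
      simp [size_pair]
      omega
    · simp [size, enc, encList, ser]
    · obtain ⟨x, y⟩ := s
      have h₁ := size_bit_le b x
      have h₂ := size_bit_le false x
      have h₃ := size_bit_le true y
      have h₄ : size (0 : ℕ) = 1 := by simp [size, enc, encList, ser]
      simp only [predStep, Polynomial.eval_ofNat]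
      split_ifs <;> omega
  refine this.snd.congr_enc fun a => ?_
  rw [foldr_predStep]

theorem lt_sub {f g : α → ℕ} (hf : PolyTime f) (hg : PolyTime g) :
    PolyTime fun a => (decide (f a < g a), f a - g a) := by
  have : PolyTime fun a => (MultiColor.digitPairs (f a) (g a)).foldl subStep (false, 0) := by
    refine foldl_of_measure (h := fun p : α × (Bool × ℕ) × (Bool × Bool) => subStep p.2.1 p.2.2)
      (by fun_prop) (by fun_prop) (by unfold subStep; fun_prop)
      -- The number of digits is the right measure here: passing to the predecessor can lengthen the
      -- code by more than a constant, as for powers of 2, but it never adds a digit.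
      (fun s => s.2.size) 1 (4 * Polynomial.X + 5) 0 (fun s => ?_)
      (fun a => ?_) fun a s b => ?_
    · obtain ⟨x, y⟩ := s
      have h₁ := size_bool_le x
      have h₂ := size_nat_le y
      simp [size_pair]
      omega
    · simp
    · obtain ⟨x, y⟩ := s
      have key : ∀ b z, z ≤ y → (Nat.bit b z).size ≤ y.size + 1 := by
        intro b z hz
        have := Nat.lt_size_self y
        rw [Nat.size_le, pow_succ, Nat.bit_val]
        have := Bool.toNat_le b
        omega
      have h₁ := key true y le_rfl
      have h₂ := key false y le_rfl
      have h₃ := key true (y - 1) (by omega)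
      simp only [subStep, Polynomial.eval_one]
      split_ifs <;> simp only [Nat.size_zero] <;> omega
  refine this.congr_enc fun a => ?_
  rw [foldl_subStep]

@[fun_prop]
theorem sub {f g : α → ℕ} (hf : PolyTime f) (hg : PolyTime g) : PolyTime fun a => f a - g a :=
  (hf.lt_sub hg).snd

@[fun_prop]
theorem decide_lt {f g : α → ℕ} (hf : PolyTime f) (hg : PolyTime g) :
    PolyTime fun a => decide (f a < g a) :=
  (hf.lt_sub hg).fst

@[fun_prop]
theorem decide_eq {f g : α → ℕ} (hf : PolyTime f) (hg : PolyTime g) :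
    PolyTime fun a => decide (f a = g a) := by
  refine (show PolyTime fun a => decide (¬ f a < g a ∧ ¬ g a < f a) by fun_prop).congr_enc
    fun a => ?_
  congr 2
  simp only [eq_iff_iff]
  omega

@[fun_prop]
theorem mul {f g : α → ℕ} (hf : PolyTime f) (hg : PolyTime g) : PolyTime fun a => f a * g a := by
  have : PolyTime fun a => (f a).bits.foldr (fun x s => Nat.bit false s + if x = true then g a else 0)
      0 := by
    obtain ⟨r, hr⟩ := hg.size_le
    refine foldr_of_measure (h := fun a x s => Nat.bit false s + if x = true then g a else 0)
      (by fun_prop) (by fun_prop) (by fun_prop)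
      Nat.size (r + 2) (4 * Polynomial.X + 1) 0 (fun s => ?_)
      (fun a => ?_) fun a b s => ?_
    · simpa using size_nat_le s
    · simp
    · have h₁ := natSize_add_le (Nat.bit false s) (if b = true then g a else 0)
      have h₂ : (Nat.bit false s).size ≤ s.size + 1 := by
        have := Nat.lt_size_self s
        rw [Nat.size_le, pow_succ, Nat.bit_val]
        simp
        omega
      have h₃ : (if b = true then g a else 0).size ≤ (g a).size := by
        split_ifs <;> simp
      have h₄ := (natSize_le_size _).trans (hr a)
      have h₅ := eval_mono r (show size a ≤ size a + size b by omega)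
      rw [Polynomial.eval_add, Polynomial.eval_ofNat]
      omega
  refine this.congr_enc fun a => ?_
  rw [foldr_mul]

@[fun_prop]
theorem div {f g : α → ℕ} (hf : PolyTime f) (hg : PolyTime g) : PolyTime fun a => f a / g a := by
  have : PolyTime fun a => (f a).bits.foldr (divStep (g a)) (0, 0) := by
    refine foldr_of_measure (h := fun a => divStep (g a))
      (by fun_prop) (by fun_prop) (by unfold divStep; fun_prop)
      (fun s => max s.1.size s.2.size) 1 (8 * Polynomial.X + 3) 0 (fun s => ?_)
      (fun a => ?_) fun a b s => ?_
    · obtain ⟨x, y⟩ := s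
      have h₁ := size_nat_le x
      have h₂ := size_nat_le y
      simp [size_pair]
      omega
    · simp
    · obtain ⟨x, y⟩ := s
      have key : ∀ b z, (Nat.bit b z).size ≤ z.size + 1 := by
        intro b z
        have := Nat.lt_size_self z
        rw [Nat.size_le, pow_succ, Nat.bit_val]
        have := Bool.toNat_le b
        omega
      have h₁ := key true x
      have h₂ := key false x
      have h₃ := key b y
      have h₄ : (Nat.bit b y - g a).size ≤ _ := Nat.size_le_size (Nat.sub_le _ _)
      simp only [divStep, Polynomial.eval_one]
      split_ifs <;> simp only <;> omega
  -- The long division is correct only for positive divisors; a quotient by zero is 0 by convention.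
  refine (show PolyTime fun a => if g a = 0 then 0 else
    ((f a).bits.foldr (divStep (g a)) (0, 0)).1 by fun_prop).congr_enc fun a => ?_
  split_ifs with h
  · rw [h, Nat.div_zero]
  · rw [foldr_divStep _ (by omega)]

@[fun_prop]
theorem length {f : α → List β} (hf : PolyTime f) : PolyTime fun a => (f a).length := by
  have : PolyTime fun a => (f a).foldr (fun _ s => s + 1) 0 := by
    refine foldr_of_measure (h := fun _ _ s => s + 1) (by fun_prop) (by fun_prop) (by fun_prop)
      Nat.size 2 (4 * Polynomial.X + 1) 0 (fun s => ?_) (fun a => ?_) fun a b s => ?_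
    · simpa using size_nat_le s
    · simp
    · have := natSize_add_le s 1
      rw [Nat.size_one] at this
      rw [Polynomial.eval_ofNat]
      omega
  refine this.congr_enc fun a => ?_
  congr 1
  induction f a with
  | nil => rfl
  | cons b l ih => rw [List.length_cons, ih, List.foldr_cons]

-- The range is indexed by the length of a list because the range of a number given in binary can be
-- exponentially long.
@[fun_prop]
theorem range_length {f : α → List β} (hf : PolyTime f) :
    PolyTime fun a => List.range (f a).length := by
  have hp : PolyTime fun p : α × (ℕ × List ℕ) × β => (p.2.1.1 + 1, p.2.1.1 :: p.2.1.2) := by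
    fun_prop
  have key : ∀ (l : List β), l.foldl (fun (s : ℕ × List ℕ) _ => (s.1 + 1, s.1 :: s.2)) (0, []) =
      (l.length, (List.range l.length).reverse) := by
    intro l
    induction l using List.reverseRecOn with
    | nil => simp
    | append_singleton l b ih => simp [ih, List.range_succ]
  have : PolyTime fun a => (f a).foldl (fun (s : ℕ × List ℕ) _ => (s.1 + 1, s.1 :: s.2)) (0, []) := by
    obtain ⟨r, hr⟩ := (hf.length).size_le
    obtain ⟨rf, hrf⟩ := hf.size_le
    refine foldl hf (by fun_prop) hp (4 * r + rf * (4 * r + 2) + 3) fun a l' hl' => ?_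
    have h := key l'
    rw [h, size_pair, size_reverse]
    have h₀ := hl'.length_le
    have h₁ := size_nat_mono h₀
    have h₂ := hr a
    have h₃ : size (List.range l'.length) ≤ _ :=
      size_le_of_forall (k := 4 * r.eval (size a) + 1) fun k hk => by
        have := size_nat_mono (show k ≤ (f a).length by
          rw [List.mem_range] at hk; omega)
        omega
    rw [List.length_range] at h₃
    have h₄ := Nat.mul_le_mul_right (4 * r.eval (size a) + 1 + 1)
      (h₀.trans ((length_le_size (f a)).trans (hrf a)))
    simp only [Polynomial.eval_add, Polynomial.eval_mul, Polynomial.eval_ofNat, add_assoc,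
      Nat.reduceAdd] at h₃ h₄ ⊢
    omega
  refine this.snd.reverse.congr_enc fun a => ?_
  rw [key, List.reverse_reverse]

end PolyTime

end MultiColor

/-! ### Integers -/

namespace MultiColor
open Enc (enc)

instance : Enc ℤ := ⟨fun z => enc (decide (z < 0), z.natAbs)⟩

theorem size_int_le (z : ℤ) : size z ≤ 4 * z.natAbs.size + 5 := by
  have h : size z = size (decide (z < 0), z.natAbs) := rfl
  have h₁ := size_nat_le z.natAbs
  have h₂ := size_bool_le (decide (z < 0))
  rw [h, size_pair]
  omega

theorem natSize_natAbs_le_size (z : ℤ) : z.natAbs.size ≤ size z := by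
  have h : size z = size (decide (z < 0), z.natAbs) := rfl
  have h₁ := natSize_le_size z.natAbs
  rw [h, size_pair]
  omega

/-- The integer with given sign and absolute value. -/
def ofSign (b : Bool) (n : ℕ) : ℤ := if b = true then -(n : ℤ) else n

theorem ofSign_natAbs (z : ℤ) : ofSign (decide (z < 0)) z.natAbs = z := by
  by_cases h : z < 0 <;> simp only [ofSign, h, decide_true, decide_false, Bool.false_eq_true,
    if_true, if_false] <;> omega

theorem ofSign_mul (b c : Bool) (m n : ℕ) :
    ofSign b m * ofSign c n = ofSign (!(b == c)) (m * n) := by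
  cases b <;> cases c <;> simp [ofSign]

theorem ofSign_tdiv (b c : Bool) (m n : ℕ) :
    (ofSign b m).tdiv (ofSign c n) = ofSign (!(b == c)) (m / n) := by
  cases b <;> cases c <;> simp [ofSign, Int.neg_tdiv, Int.tdiv_neg]

namespace PolyTime

variable {α β : Type} [Enc α] [Enc β]

@[fun_prop]
theorem ofSign {f : α → Bool} {g : α → ℕ} (hf : PolyTime f) (hg : PolyTime g) :
    PolyTime fun a => ofSign (f a) (g a) := by
  -- The sign of 0 has to be normalized, because the code of the integer 0 carries the sign `false`.
  refine (show PolyTime fun a => (f a && !decide (g a = 0), g a) by fun_prop).congr_enc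
    fun a => ?_
  change enc (decide (MultiColor.ofSign (f a) (g a) < 0), (MultiColor.ofSign (f a) (g a)).natAbs) = _
  generalize g a = n
  cases f a
  · rw [show decide (MultiColor.ofSign false n < 0) = false by simp [MultiColor.ofSign]]
    simp [MultiColor.ofSign]
  · simp [MultiColor.ofSign, Nat.pos_iff_ne_zero]

@[fun_prop]
theorem natAbs {f : α → ℤ} (hf : PolyTime f) : PolyTime fun a => (f a).natAbs :=
  (show PolyTime fun a => (decide (f a < 0), (f a).natAbs) from hf.congr_enc fun _ => rfl).snd

theorem decide_neg {f : α → ℤ} (hf : PolyTime f) : PolyTime fun a => decide (f a < 0) :=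
  (show PolyTime fun a => (decide (f a < 0), (f a).natAbs) from hf.congr_enc fun _ => rfl).fst

@[fun_prop]
theorem natCast {f : α → ℕ} (hf : PolyTime f) : PolyTime fun a => (f a : ℤ) :=
  (ofSign (const false) hf).congr_enc fun _ => rfl

@[fun_prop]
theorem int_neg {f : α → ℤ} (hf : PolyTime f) : PolyTime fun a => -f a := by
  refine (ofSign hf.decide_neg.not hf.natAbs).congr_enc fun a => congrArg enc ?_
  by_cases h : f a < 0 <;> simp only [MultiColor.ofSign, h, decide_true, decide_false, Bool.not_true,
    Bool.not_false, Bool.false_eq_true, if_true, if_false] <;> omega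

@[fun_prop]
theorem int_add {f g : α → ℤ} (hf : PolyTime f) (hg : PolyTime g) :
    PolyTime fun a => f a + g a := by
  have h₁ := hf.decide_neg
  have h₂ := hg.decide_neg
  refine (show PolyTime fun a => if (decide (f a < 0) == decide (g a < 0)) = true then
      MultiColor.ofSign (decide (f a < 0)) ((f a).natAbs + (g a).natAbs)
    else if (f a).natAbs < (g a).natAbs then
      MultiColor.ofSign (decide (g a < 0)) ((g a).natAbs - (f a).natAbs)
    else MultiColor.ofSign (decide (f a < 0)) ((f a).natAbs - (g a).natAbs) by
      fun_prop).congr_enc fun a => congrArg enc ?_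
  by_cases hf : f a < 0 <;> by_cases hg : g a < 0 <;>
    simp only [MultiColor.ofSign, hf, hg, decide_true, decide_false, beq_self_eq_true,
      show (true == false) = false from rfl, show (false == true) = false from rfl,
      Bool.false_eq_true, if_true, if_false] <;> omega

@[fun_prop]
theorem int_sub {f g : α → ℤ} (hf : PolyTime f) (hg : PolyTime g) :
    PolyTime fun a => f a - g a := by
  simpa only [sub_eq_add_neg] using hf.int_add hg.int_neg

@[fun_prop]
theorem int_decide_lt {f g : α → ℤ} (hf : PolyTime f) (hg : PolyTime g) :
    PolyTime fun a => decide (f a < g a) := by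
  simpa only [sub_neg] using (hf.int_sub hg).decide_neg

@[fun_prop]
theorem int_decide_eq {f g : α → ℤ} (hf : PolyTime f) (hg : PolyTime g) :
    PolyTime fun a => decide (f a = g a) := by
  refine (show PolyTime fun a => decide (¬ f a < g a ∧ ¬ g a < f a) by fun_prop).congr_enc
    fun a => ?_
  congr 2
  simp only [eq_iff_iff]
  omega

@[fun_prop]
theorem int_mul {f g : α → ℤ} (hf : PolyTime f) (hg : PolyTime g) :
    PolyTime fun a => f a * g a := by
  have h₁ := hf.decide_neg
  have h₂ := hg.decide_neg
  refine (show PolyTime fun a => MultiColor.ofSign (!(decide (f a < 0) == decide (g a < 0)))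
    ((f a).natAbs * (g a).natAbs) by fun_prop).congr_enc fun a => congrArg enc ?_
  rw [← ofSign_mul, ofSign_natAbs, ofSign_natAbs]

@[fun_prop]
theorem int_tdiv {f g : α → ℤ} (hf : PolyTime f) (hg : PolyTime g) :
    PolyTime fun a => (f a).tdiv (g a) := by
  have h₁ := hf.decide_neg
  have h₂ := hg.decide_neg
  refine (show PolyTime fun a => MultiColor.ofSign (!(decide (f a < 0) == decide (g a < 0)))
    ((f a).natAbs / (g a).natAbs) by fun_prop).congr_enc fun a => congrArg enc ?_
  rw [← ofSign_tdiv, ofSign_natAbs, ofSign_natAbs]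

end PolyTime

/-! ### Input and output of words -/

/-- Moves the first letter of the input stack, which is among the given ones, to the front of the
list on the data stack. -/
def readLetter : List Letter → Prog
  | [] => skip
  | a :: l => .ite .io (isLetter a) (.pop .io ⨾ pushAll (.one :: ser (enc a))) (readLetter l)

theorem runIn_readLetter {l : List Letter} {a : Letter} (h : a ∈ l) (io x y) :
    RunIn (readLetter l) ⟨a :: io, x, y, [], []⟩ ⟨io, .one :: (ser (enc a) ++ x), y, [], []⟩
      (l.length + 20) := by
  induction l with
  | nil => simp at h
  | cons b l ih =>
    by_cases hb : a = b
    · subst hb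
      refine (RunIn.ite_true ?_ (.seq (.pop _ _) (runIn_pushAll _ _ _ _))).mono ?_
      · simp [Mem.get, isLetter]
      · cases a <;> simp [ser, enc, Letter.index, encList, List.replicate]
    · refine (RunIn.ite_false ?_ (ih ((List.mem_cons.1 h).resolve_left hb))).mono ?_
      · simpa [Mem.get, isLetter] using hb
      · simp; omega

/-- The letters in the order of their positions. -/
def letters : List Letter := [.zero, .one, .minus, .slash, .comma, .semicolon, .bar]

/-- Reads the input. -/
def readInput : Prog := .push .data .zero ⨾ .loop .io Option.isSome (readLetter letters)

/-- Every letter is put in front of the list read so far, so the list ends up reversed; the initial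
`zero` is the empty list. -/
theorem runIn_readInput (w : List Letter) :
    RunIn readInput ⟨w, [], [], [], []⟩ ⟨[], ser (enc w.reverse), [], [], []⟩
      (28 * w.length + 2) := by
  have key : ∀ w l : List Letter, RunIn (.loop .io Option.isSome (readLetter letters))
      ⟨w, ser (enc l), [], [], []⟩ ⟨[], ser (enc (w.reverse ++ l)), [], [], []⟩
      (28 * w.length + 1) := by
    intro w
    induction w with
    | nil => intro l; exact .loop_done rfl
    | cons a w ih =>
      intro l
      have := ih (a :: l)
      refine (RunIn.loop_step rfl (runIn_readLetter (show a ∈ letters by cases a <;> decide)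
        _ _ _) (s'' := ⟨[], ser (enc ((a :: w).reverse ++ l)), [], [], []⟩)
        (t' := 28 * w.length + 1) ?_).mono ?_
      · simpa [enc, encList, ser] using this
      · simp [letters]; omega
  have := key w []
  rw [List.append_nil] at this
  exact (RunIn.seq (.push _ _ _) this).mono (by omega)

/-- Moves a letter with a code on the data stack to the output stack; the argument lists the
letters by their codes. -/
def writeLetter : List Letter → Prog
  | [] => skip
  | a :: l => .ite .data (isLetter .zero) (.pop .data ⨾ .push .io a)
      (.pop .data ⨾ .pop .data ⨾ writeLetter l)

/-- Each unit in the unary code contributes a node letter and a leaf, so two pops advance to the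
next candidate letter. -/
theorem runIn_writeLetter {l : List Letter} {k : ℕ} {a : Letter} (h : l[k]? = some a) (io x y) :
    RunIn (writeLetter l) ⟨io, ser (enc (List.replicate k ())) ++ x, y, [], []⟩
      ⟨a :: io, x, y, [], []⟩ (3 * (k + 1)) := by
  induction l generalizing k with
  | nil => simp at h
  | cons b l ih =>
    cases k with
    | zero =>
      obtain rfl : b = a := by simpa using h
      exact .ite_true rfl (.seq (.pop _ _) (.push _ _ _))
    | succ k =>
      refine (RunIn.ite_false rfl (.seq (.pop _ _) (.seq (.pop _ _)
        (ih (k := k) (by simpa using h))))).mono ?_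
      omega

/-- Writes the output. -/
def writeOutput : Prog :=
  .loop .data (isLetter .one) (.pop .data ⨾ writeLetter letters) ⨾ .pop .data

theorem runIn_writeOutput (l : List Letter) :
    RunIn writeOutput ⟨[], ser (enc l), [], [], []⟩ ⟨l.reverse, [], [], [], []⟩
      (24 * l.length + 2) := by
  have key : ∀ l io : List Letter, RunIn (.loop .data (isLetter .one) (.pop .data ⨾ writeLetter letters))
      ⟨io, ser (enc l), [], [], []⟩ ⟨l.reverse ++ io, [.zero], [], [], []⟩
      (24 * l.length + 1) := by
    intro l
    induction l with
    | nil => intro io; exact .loop_done rfl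
    | cons a l ih =>
      intro io
      have h₁ := ih (a :: io)
      have h₂ := runIn_writeLetter (l := letters) (k := a.index) (a := a)
        (by cases a <;> rfl) io (ser (enc l)) []
      rw [List.reverse_cons, List.append_assoc]
      refine (RunIn.loop_step rfl (.seq (.pop _ _) h₂) h₁).mono ?_
      have : a.index ≤ 6 := by cases a <;> simp [Letter.index]
      simp
      omega
  have := key l []
  rw [List.append_nil] at this
  exact (RunIn.seq this (.pop _ _)).mono (by omega)

theorem computability_encodeNat (k : ℕ) : Computability.encodeNat k = k.bits := by
  have key : ∀ n : PosNum, Computability.encodePosNum n = (n : ℕ).bits := by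
    intro n
    induction n with
    | one => simp [Computability.encodePosNum]
    | bit0 n ih =>
      rw [Computability.encodePosNum, ih, PosNum.cast_bit0,
        show ((n : ℕ) + n) = Nat.bit false n by rw [Nat.bit_val]; simp; ring,
        Nat.bits_append_bit]
      intro h
      exact absurd h (PosNum.to_nat_pos n).ne'
    | bit1 n ih =>
      rw [Computability.encodePosNum, ih, PosNum.cast_bit1,
        show ((n : ℕ) + n + 1) = Nat.bit true n by rw [Nat.bit_val]; simp; ring,
        Nat.bits_append_bit]
      simp
  conv_rhs => rw [← Num.to_of_nat k]
  unfold Computability.encodeNat Computability.encodeNum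
  cases (k : Num) with
  | zero => simp
  | pos n => exact key n

theorem encodeNat_eq (k : ℕ) :
    encodeNat k = k.bits.map fun b => if b then Letter.one else Letter.zero := by
  rw [encodeNat, computability_encodeNat]

/-- The reversed word is exactly what `readInput` leaves on the data stack. -/
instance : Enc Input := ⟨fun I => enc (encodeInput I).reverse⟩

theorem size_input_le (I : Input) : size I ≤ 14 * (encodeInput I).length + 1 := by
  have h : size I = size (encodeInput I).reverse := rfl
  rw [h, size_reverse]
  refine (size_le_of_forall (k := 13) fun a _ => ?_).trans (by omega)
  cases a <;> simp [size, enc, Letter.index, encList, ser, List.replicate]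

theorem PolyTime.encodeNatList {α : Type} [Enc α] {f : α → List ℕ} (hf : PolyTime f) :
    PolyTime fun a => encodeNatList (f a) := by
  refine (show PolyTime fun a => ((f a).map fun k =>
      k.bits.map (fun b => if b = true then Letter.one else Letter.zero) ++ [Letter.comma]).flatten
    from (map hf (append (map (h := fun (_ : α × ℕ) b => if b = true then Letter.one else
      Letter.zero) (by fun_prop) (by fun_prop)) (by fun_prop))).flatten).congr_enc fun a => ?_
  rw [MultiColor.encodeNatList]
  simp only [encodeNat_eq]

/-- A function that is computed in polynomial time with respect to codes is computed by a machine
in polynomial time. -/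
theorem PolyTime.nonempty_computable {f : Input → List ℕ} (hf : PolyTime f) :
    Nonempty (Turing.TM2ComputableInPolyTime encodeInput MultiColor.encodeNatList f) := by
  -- Writing reverses the word once more, so the program has to compute the reversed output.
  have h := hf.encodeNatList.reverse
  obtain ⟨r, hr⟩ := h.size_le
  obtain ⟨p, q, hp⟩ := h
  refine nonempty_computable_of_run (readInput ⨾ p ⨾ writeOutput)
    (28 * Polynomial.X + q.comp (14 * Polynomial.X + 1) + 24 * r.comp (14 * Polynomial.X + 1) + 4)
    fun I => ?_
  have h₁ := hp I [] [] []
  rw [List.append_nil, List.append_nil] at h₁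
  have h₂ := RunIn.seq (runIn_readInput (encodeInput I)) (.seq h₁ (runIn_writeOutput _))
  rw [List.reverse_reverse] at h₂
  refine h₂.mono ?_
  have h₃ := (length_le_size _).trans (hr I)
  have h₄ := eval_mono r (size_input_le I)
  have h₅ := eval_mono q (size_input_le I)
  simp [Polynomial.eval_comp] at *
  omega

end MultiColor

/-! ### Parsing the input word -/

namespace MultiColor
open Enc (enc)

section

variable {α β γ : Type} [Enc α] [Enc β] [Enc γ]

theorem size_int_eq (z : ℤ) : size z = size (decide (z < 0)) + size z.natAbs + 1 :=
  size_pair (decide (z < 0)) z.natAbs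

theorem size_headD_add_le (l : List α) (d : α) :
    size (l.headD d) + size l.tail ≤ size l + size d := by
  cases l with
  | nil => simp; omega
  | cons a l => simp [size_cons]; omega

@[fun_prop]
theorem PolyTime.list_sum {f : α → List ℤ} (hf : PolyTime f) : PolyTime fun a => (f a).sum := by
  have : PolyTime fun a => (f a).foldr (fun x s => x + s) 0 := by
    refine foldr_of_measure (h := fun _ x s => x + s) (by fun_prop) (by fun_prop) (by fun_prop)
      (fun z => z.natAbs.size) (Polynomial.X + 1) (4 * Polynomial.X + 5) 0 (fun s => ?_)
      (fun a => ?_) fun a b s => ?_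
    · simpa using size_int_le s
    · simp
    · have h₁ := Nat.size_le_size (Int.natAbs_add_le b s)
      have h₂ := natSize_add_le b.natAbs s.natAbs
      have h₃ := natSize_natAbs_le_size b
      simp
      omega
  refine this.congr_enc fun a => ?_
  rw [List.sum_eq_foldr]

@[fun_prop]
theorem PolyTime.list_prod {f : α → List ℕ} (hf : PolyTime f) : PolyTime fun a => (f a).prod := by
  have : PolyTime fun a => (f a).foldr (fun x s => x * s) 1 := by
    refine foldr_of_measure (h := fun _ x s => x * s) (by fun_prop) (by fun_prop) (by fun_prop)
      Nat.size Polynomial.X (4 * Polynomial.X + 1) 1 (fun s => ?_) (fun a => ?_) fun a b s => ?_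
    · simpa using size_nat_le s
    · simp
    · have h₂ := natSize_mul_le b s
      have h₃ := natSize_le_size b
      simp
      omega
  refine this.congr_enc fun a => ?_
  rw [List.prod_eq_foldr]

end

/-- Modifies the first number of the first vector of the first item. -/
def modifyFirst (f : ℤ × ℕ → ℤ × ℕ) (s : List (List (List (ℤ × ℕ)))) :
    List (List (List (ℤ × ℕ))) :=
  ((f (((s.headD []).headD []).headD (0, 0)) :: ((s.headD []).headD []).tail) ::
    (s.headD []).tail) :: s.tail

/-- Appends a leading binary digit to the number that is being read. -/
def pushDigit (b : Bool) (q : ℤ × ℕ) : ℤ × ℕ := (ofSign false (Nat.bit b q.1.natAbs), q.2)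

/-- Reads a letter of the input word, from right to left. -/
def parseStep (a : Letter) (s : List (List (List (ℤ × ℕ)))) : List (List (List (ℤ × ℕ))) :=
  if a = .bar then [] :: s
  else if a = .semicolon then ([] :: s.headD []) :: s.tail
  else if a = .comma then
    (((0, 0) :: (s.headD []).headD []) :: (s.headD []).tail) :: s.tail
  else if a = .slash then modifyFirst (fun q => (0, q.1.natAbs)) s
  else if a = .minus then modifyFirst (fun q => (-q.1, q.2)) s
  else if a = .one then modifyFirst (pushDigit true) s
  else modifyFirst (pushDigit false) s

theorem size_modifyFirst_le {f : ℤ × ℕ → ℤ × ℕ} (hf : ∀ q, size (f q) ≤ size q + 10)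
    (s : List (List (List (ℤ × ℕ)))) : size (modifyFirst f s) ≤ size s + 30 := by
  have h₁ := size_headD_add_le s []
  have h₂ := size_headD_add_le (s.headD []) []
  have h₃ := size_headD_add_le ((s.headD []).headD []) (0, 0)
  have h₄ := hf (((s.headD []).headD []).headD (0, 0))
  have h₅ : size ((0, 0) : ℤ × ℕ) = 5 := by simp [size, enc, encList, ser]
  simp only [modifyFirst, size_cons, size_nil] at *
  omega

theorem PolyTime.parseStep {α : Type} [Enc α] {f : α → Letter} {g : α → List (List (List (ℤ × ℕ)))}
    (hf : PolyTime f) (hg : PolyTime g) : PolyTime fun a => parseStep (f a) (g a) := by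
  unfold MultiColor.parseStep modifyFirst pushDigit
  fun_prop

theorem size_parseStep_le (a : Letter) (s : List (List (List (ℤ × ℕ)))) :
    size (parseStep a s) ≤ size s + 30 := by
  have h₁ := size_headD_add_le s []
  have h₂ := size_headD_add_le (s.headD []) []
  have h₅ : size ((0, 0) : ℤ × ℕ) = 5 := by simp [size, enc, encList, ser]
  have h₆ : size (0 : ℤ) = 3 := by simp [size, enc, encList, ser]
  have hd : ∀ b q, size (pushDigit b q) ≤ size q + 10 := by
    rintro b ⟨z, d⟩
    have h₁ := size_bit_le b z.natAbs
    have h₂ := size_bool_le (decide (ofSign false (Nat.bit b z.natAbs) < 0))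
    have h₃ : (ofSign false (Nat.bit b z.natAbs)).natAbs = Nat.bit b z.natAbs := by simp [ofSign]
    have h₄ := one_le_size (decide (z < 0))
    rw [pushDigit, size_pair, size_pair, size_int_eq, size_int_eq z]
    simp only [h₃] at *
    omega
  unfold parseStep
  simp only [size_nil] at h₁ h₂
  split_ifs
  · rw [size_cons, size_nil]; omega
  · simp only [size_cons, size_nil]; omega
  · simp only [size_cons]; omega
  · refine size_modifyFirst_le (fun q => ?_) s
    obtain ⟨z, d⟩ := q
    change size ((0 : ℤ), z.natAbs) ≤ size (z, d) + 10
    rw [size_pair, size_pair, size_int_eq z]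
    omega
  · refine size_modifyFirst_le (fun q => ?_) s
    obtain ⟨z, d⟩ := q
    have h₃ := size_bool_le (decide (-z < 0))
    have h₄ := one_le_size (decide (z < 0))
    change size (-z, d) ≤ size (z, d) + 10
    rw [size_pair, size_pair, size_int_eq z, size_int_eq (-z), Int.natAbs_neg]
    omega
  · exact size_modifyFirst_le (hd _) s
  · exact size_modifyFirst_le (hd _) s

/-- Numbers are written with the least significant digit first, so reading from right to left meets
the leading digit first and each further digit is appended by `Nat.bit`. -/
theorem foldr_parseStep_encodeNat (k d : ℕ) (v : List (ℤ × ℕ)) (t : List (List (ℤ × ℕ)))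
    (s : List (List (List (ℤ × ℕ)))) :
    (encodeNat k).foldr parseStep ((((0, d) :: v) :: t) :: s) = ((((k : ℤ), d) :: v) :: t) :: s := by
  rw [encodeNat_eq]
  induction k using Nat.binaryRec' with
  | zero => simp
  | bit b n h ih =>
    rw [Nat.bits_append_bit n b h, List.map_cons, List.foldr_cons, ih]
    cases b <;> simp [parseStep, modifyFirst, pushDigit, ofSign]

/-- From right to left, the comma opens a fraction, the denominator is read into the integer slot,
the slash moves it to the second slot, and the numerator is read into the slot thus cleared; a minus
sign comes last. -/
theorem foldr_parseStep_encodeRat (q : ℚ) (v : List (ℤ × ℕ)) (t : List (List (ℤ × ℕ)))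
    (s : List (List (List (ℤ × ℕ)))) :
    (encodeRat q ++ [Letter.comma]).foldr parseStep ((v :: t) :: s) =
      (((q.num, q.den) :: v) :: t) :: s := by
  rw [encodeRat]
  simp only [List.foldr_append, List.foldr_cons, List.foldr_nil]
  rw [show parseStep .comma ((v :: t) :: s) = (((0, 0) :: v) :: t) :: s by simp [parseStep],
    foldr_parseStep_encodeNat,
    show parseStep .slash (((((q.den : ℤ), 0) :: v) :: t) :: s) = (((0, q.den) :: v) :: t) :: s by
      simp [parseStep, modifyFirst],
    foldr_parseStep_encodeNat]
  split_ifs with h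
  · have : -(|q.num| : ℤ) = q.num := by
      rw [abs_of_neg (Rat.num_neg.2 h), neg_neg]
    simp [parseStep, modifyFirst, this]
  · have : (|q.num| : ℤ) = q.num := abs_of_nonneg (Rat.num_nonneg.2 (not_lt.1 h))
    simp [this]

theorem foldr_parseStep_vector (l : List ℚ) (v : List (ℤ × ℕ)) (t : List (List (ℤ × ℕ)))
    (s : List (List (List (ℤ × ℕ)))) :
    (l.map fun q => encodeRat q ++ [Letter.comma]).flatten.foldr parseStep ((v :: t) :: s) =
      (((l.map fun q => (q.num, q.den)) ++ v) :: t) :: s := by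
  induction l with
  | nil => simp
  | cons q l ih =>
    rw [List.map_cons, List.flatten_cons, List.foldr_append, ih, foldr_parseStep_encodeRat]
    simp

theorem foldr_parseStep_item (l : List (List ℚ)) (t : List (List (ℤ × ℕ)))
    (s : List (List (List (ℤ × ℕ)))) :
    (l.map fun w => (w.map fun q => encodeRat q ++ [Letter.comma]).flatten ++
      [Letter.semicolon]).flatten.foldr parseStep (t :: s) =
      ((l.map fun w => w.map fun q => (q.num, q.den)) ++ t) :: s := by
  induction l with
  | nil => simp
  | cons w l ih =>
    rw [List.map_cons, List.flatten_cons, List.foldr_append, ih, List.foldr_append,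
      List.foldr_cons, List.foldr_nil]
    simpa [parseStep] using foldr_parseStep_vector w [] _ s

theorem foldr_parseStep (l : List (List (List ℚ))) (s : List (List (List (ℤ × ℕ)))) :
    (l.map fun t => (t.map fun w => (w.map fun q => encodeRat q ++ [Letter.comma]).flatten ++
      [Letter.semicolon]).flatten ++ [Letter.bar]).flatten.foldr parseStep s =
      (l.map fun t => t.map fun w => w.map fun q => (q.num, q.den)) ++ s := by
  induction l with
  | nil => simp
  | cons t l ih =>
    rw [List.map_cons, List.flatten_cons, List.foldr_append, ih, List.foldr_append,
      List.foldr_cons, List.foldr_nil]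
    simpa [parseStep] using foldr_parseStep_item t [] _

/-- The numerators and denominators of an input, as nested lists. -/
def Input.fractions (I : Input) : List (List (List (ℤ × ℕ))) :=
  List.ofFn fun j => List.ofFn fun r => List.ofFn fun i => ((I.v j r i).num, (I.v j r i).den)

theorem foldr_parseStep_encodeInput (I : Input) :
    (encodeInput I).foldr parseStep [] = I.fractions := by
  have := foldr_parseStep
    (List.ofFn fun j => List.ofFn fun r => List.ofFn fun i => I.v j r i) []
  simpa [encodeInput, Input.fractions, List.map_ofFn, Function.comp_def] using this

theorem PolyTime.fractions : PolyTime Input.fractions := by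
  have h₀ : PolyTime fun I : Input => (encodeInput I).reverse := of_enc fun _ => rfl
  have : PolyTime fun I : Input => (encodeInput I).reverse.reverse.foldr MultiColor.parseStep [] := by
    refine foldr_of_size_le (h := fun _ => MultiColor.parseStep) h₀.reverse (const _)
      (parseStep (by fun_prop) (by fun_prop)) 30 fun a b s => ?_
    simpa using size_parseStep_le b s
  refine this.congr_enc fun I => ?_
  rw [List.reverse_reverse, foldr_parseStep_encodeInput]

end MultiColor

/-! ### The tableau algorithm and the complexity of one step -/

namespace MultiColor
open Enc (enc)

/-- The sum of the products of the entries of two vectors. -/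
def dot (u v : List ℤ) : ℤ := (List.zipWith (fun a b => a * b) u v).sum

/-- A tableau: the denominator, the labels of the basic columns (`none` for an artificial column),
the current solution, and the columns not yet treated. -/
abbrev Tableau : Type := ℤ × List (Option (ℕ × ℕ)) × List ℤ × List (List ℤ)

/-- The bound, as numerator and denominator, that a row with label `e`, current value `p.1` and
entry `p.2` in the new column puts on the step length; `none` if a full step is possible. -/
def pivotKey (e : Option (ℕ × ℕ)) (p : ℤ × ℤ) : Option (ℤ × ℤ) :=
  if e.isNone = true then if p.2 = 0 then none else some (0, 1)
  else if p.1 + p.2 < 0 then some (p.1, -p.2) else none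

/-- Looks for the smallest bound in a list of bounds; the state consists of this bound and its
position. -/
def selectStep (k : Option (ℤ × ℤ)) (s : Option (ℤ × ℤ) × ℕ) : Option (ℤ × ℤ) × ℕ :=
  match k with
  | none => (s.1, s.2 + 1)
  | some q =>
    match s.1 with
    | none => (some q, 0)
    | some q' => if q.1 * q'.2 < q'.1 * q.2 then (some q, 0) else (s.1, s.2 + 1)

/-- The transformation of a column `u` under a pivot step. -/
def reduceCol (d tp : ℤ) (tt mask u : List ℤ) : List ℤ :=
  List.zipWith (fun a b => (a * tp - b * dot mask u).tdiv d) u tt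

/-- The pivot step in the row marked by the unit vector `mask`, where `t` is the new column, `id`
its label, and `y` the current solution after a full step. -/
def pivot (id : ℕ × ℕ) (D : ℤ) (tags : List (Option (ℕ × ℕ))) (y t mask : List ℤ)
    (cols : List (List ℤ)) : Tableau :=
  (((dot mask t).natAbs : ℤ),
    List.zipWith (fun a e => if a = 1 then some id else e) mask tags,
    reduceCol (if dot mask t < 0 then -D else D) (dot mask t)
      (List.zipWith (fun a b => a - D * b) t mask) mask y,
    cols.map (reduceCol (if dot mask t < 0 then -D else D) (dot mask t)
      (List.zipWith (fun a b => a - D * b) t mask) mask))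

/-- The position of the smallest bound. -/
def select (tags : List (Option (ℕ × ℕ))) (x t : List ℤ) : Option (ℤ × ℤ) × ℕ :=
  (List.zipWith pivotKey tags (x.zip t)).foldr selectStep (none, 0)

/-- A unit vector. -/
def unitVec (t : List ℤ) (k : ℕ) : List ℤ :=
  (List.range t.length).map fun i => if i = k then 1 else 0

/-- Treats the next column, whose label is `id`. -/
def step (id : ℕ × ℕ) (s : Tableau) : Tableau :=
  if (select s.2.1 s.2.2.1 (s.2.2.2.headD [])).1.isNone = true then
    (s.1, s.2.1, List.zipWith (fun a b => a + b) s.2.2.1 (s.2.2.2.headD []), s.2.2.2.tail)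
  else
    pivot id s.1 s.2.1 (List.zipWith (fun a b => a + b) s.2.2.1 (s.2.2.2.headD []))
      (s.2.2.2.headD [])
      (unitVec (s.2.2.2.headD []) (select s.2.1 s.2.2.1 (s.2.2.2.headD [])).2) s.2.2.2.tail

/-- The color that item `j` gets: the color in the first label of `j` with positive value. -/
def pickColor (j : ℕ) (tags : List (Option (ℕ × ℕ))) (x : List ℤ) : ℕ :=
  (tags.zip x).foldr (fun p s =>
    if p.1.toList.isEmpty = false ∧ (p.1.toList.headD (0, 0)).1 = j ∧ 0 < p.2
    then (p.1.toList.headD (0, 0)).2 else s) 0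

namespace PolyTime

variable {α β : Type} [Enc α] [Enc β]

@[fun_prop]
theorem isNone {f : α → Option β} (hf : PolyTime f) : PolyTime fun a => (f a).isNone := by
  refine hf.toList.isEmpty.congr_enc fun a => ?_
  cases f a <;> rfl

@[fun_prop]
theorem dot {f g : α → List ℤ} (hf : PolyTime f) (hg : PolyTime g) :
    PolyTime fun a => dot (f a) (g a) :=
  (zipWith (h := fun _ a b => a * b) hf hg (by fun_prop)).list_sum

theorem pivotKey : PolyTime fun p : Option (ℕ × ℕ) × ℤ × ℤ => pivotKey p.1 p.2 := by
  unfold MultiColor.pivotKey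
  fun_prop

theorem selectStep : PolyTime fun p : Option (ℤ × ℤ) × Option (ℤ × ℤ) × ℕ =>
    selectStep p.1 p.2 := by
  refine (option_cases (f := fun p : Option (ℤ × ℤ) × Option (ℤ × ℤ) × ℕ => p.1)
    (g := fun p => (p.2.1, p.2.2 + 1))
    (h := fun p q => match p.2.1 with
      | none => (Option.some q, 0)
      | .some q' => if q.1 * q'.2 < q'.1 * q.2 then (Option.some q, 0) else (p.2.1, p.2.2 + 1))
    (by fun_prop) (by fun_prop) ?_).congr_enc
      fun a => by obtain ⟨_ | _, _ | _, _⟩ := a <;> rfl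
  refine (option_cases (f := fun a : (Option (ℤ × ℤ) × Option (ℤ × ℤ) × ℕ) × ℤ × ℤ => a.1.2.1)
    (g := fun a => (Option.some a.2, 0))
    (h := fun a q' => if a.2.1 * q'.2 < q'.1 * a.2.2 then (Option.some a.2, 0)
      else (a.1.2.1, a.1.2.2 + 1)) (by fun_prop) (by fun_prop) (by fun_prop)).congr_enc
      fun a => by obtain ⟨⟨_, _ | _, _⟩, _⟩ := a <;> rfl

@[fun_prop]
theorem select {e : α → List (Option (ℕ × ℕ))} {f g : α → List ℤ} (he : PolyTime e)
    (hf : PolyTime f) (hg : PolyTime g) : PolyTime fun a => select (e a) (f a) (g a) := by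
  refine foldr_of_measure (h := fun _ => MultiColor.selectStep)
    (zipWith (h := fun _ => MultiColor.pivotKey) he (hf.zip hg) (pivotKey.comp
      (f := fun p : α × Option (ℕ × ℕ) × ℤ × ℤ => (p.2.1, p.2.2)) (by fun_prop))) (const _)
    (selectStep.comp (f := fun p : α × Option (ℤ × ℤ) × Option (ℤ × ℤ) × ℕ => (p.2.1, p.2.2))
      (by fun_prop)) (fun s => size s.1 + s.2.size) (Polynomial.X + 1) (4 * Polynomial.X + 2) 1
      (fun s => ?_) (fun a => ?_) fun a k s => ?_
  · have := size_nat_le s.2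
    obtain ⟨s, n⟩ := s
    simp only [size_pair] at *
    simp
    omega
  · simp [size, enc, encList, ser]
  · have h₁ := natSize_add_le s.2 1
    rw [Nat.size_one] at h₁
    have h₂ := one_le_size s.1
    have h₃ := one_le_size a
    rw [Polynomial.eval_add, Polynomial.eval_X, Polynomial.eval_one]
    unfold MultiColor.selectStep
    split
    · dsimp only; omega
    · split
      · simp only [Nat.size_zero]; omega
      · split_ifs
        · simp only [Nat.size_zero]; omega
        · dsimp only; omega

@[fun_prop]
theorem unitVec {f : α → List ℤ} {g : α → ℕ} (hf : PolyTime f) (hg : PolyTime g) :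
    PolyTime fun a => unitVec (f a) (g a) :=
  map (h := fun a i => if i = g a then 1 else 0) (by fun_prop) (by fun_prop)

theorem reduceCol {d p : α → ℤ} {t k u : α → List ℤ} (hd : PolyTime d) (hp : PolyTime p)
    (ht : PolyTime t) (hk : PolyTime k) (hu : PolyTime u) :
    PolyTime fun a => reduceCol (d a) (p a) (t a) (k a) (u a) :=
  zipWith (h := fun a x y => (x * p a - y * MultiColor.dot (k a) (u a)).tdiv (d a)) hu ht
    (by fun_prop)

theorem zipWith_add {f g : α → List ℤ} (hf : PolyTime f) (hg : PolyTime g) :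
    PolyTime fun a => List.zipWith (fun a b => a + b) (f a) (g a) :=
  zipWith (h := fun _ a b => a + b) hf hg (by fun_prop)

theorem pivot {i : α → ℕ × ℕ} {D : α → ℤ} {e : α → List (Option (ℕ × ℕ))} {y t k : α → List ℤ}
    {c : α → List (List ℤ)} (hi : PolyTime i) (hD : PolyTime D) (he : PolyTime e)
    (hy : PolyTime y) (ht : PolyTime t) (hk : PolyTime k) (hc : PolyTime c) :
    PolyTime fun a => pivot (i a) (D a) (e a) (y a) (t a) (k a) (c a) := by
  have h₁ : PolyTime fun a => List.zipWith (fun x y => x - D a * y) (t a) (k a) :=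
    zipWith (h := fun a x y => x - D a * y) ht hk (by fun_prop)
  have h₂ : PolyTime fun a => List.zipWith (fun x e => if x = 1 then Option.some (i a) else e)
      (k a) (e a) :=
    zipWith (h := fun a x e => if x = 1 then Option.some (i a) else e) hk he (by fun_prop)
  have h₃ : PolyTime fun a => if MultiColor.dot (k a) (t a) < 0 then -D a else D a := by fun_prop
  have h₄ := hk.dot ht
  exact (natCast (natAbs h₄)).pair (h₂.pair ((reduceCol h₃ h₄ h₁ hk hy).pair
    (map (h := fun a => MultiColor.reduceCol _ _ _ _) hc
      (reduceCol (h₃.comp fst') (h₄.comp fst') (h₁.comp fst') (hk.comp fst') snd'))))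

theorem step : PolyTime fun p : (ℕ × ℕ) × Tableau => step p.1 p.2 := by
  have h := zipWith_add (f := fun p : (ℕ × ℕ) × Tableau => p.2.2.2.1)
    (g := fun p => p.2.2.2.2.headD []) (by fun_prop) (by fun_prop)
  unfold MultiColor.step
  refine ite (by fun_prop) (by fun_prop) (pivot (by fun_prop) (by fun_prop) (by fun_prop) h
    (by fun_prop) (by fun_prop) (by fun_prop))

theorem pickColor {j : α → ℕ} {e : α → List (Option (ℕ × ℕ))} {x : α → List ℤ} (hj : PolyTime j)
    (he : PolyTime e) (hx : PolyTime x) : PolyTime fun a => pickColor (j a) (e a) (x a) := by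
  have hb : PolyTime fun p : α × (Option (ℕ × ℕ) × ℤ) × ℕ => decide (p.2.1.1.toList.isEmpty = false) :=
    (show PolyTime fun p : α × (Option (ℕ × ℕ) × ℤ) × ℕ => !p.2.1.1.toList.isEmpty by
      fun_prop).congr_enc fun a => by cases a.2.1.1.toList.isEmpty <;> rfl
  refine foldr_of_size_le (h := fun a p s =>
    if p.1.toList.isEmpty = false ∧ (p.1.toList.headD (0, 0)).1 = j a ∧ 0 < p.2
    then (p.1.toList.headD (0, 0)).2 else s) (he.zip hx) (const 0)
    (by fun_prop) Polynomial.X fun a b s => ?_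
  rw [Polynomial.eval_X]
  split_ifs with h
  · obtain ⟨o, z⟩ := b
    cases o with
    | none => simp at h
    | some q =>
      have : size ((Option.some q, z) : Option (ℕ × ℕ) × ℤ) = size q + 1 + 1 + size z + 1 := by
        rw [size_pair, show size (Option.some q) = size [q] from rfl, size_cons, size_nil]
      have h' : size q = size q.1 + size q.2 + 1 := size_pair q.1 q.2
      simp only [Option.toList_some, List.headD_cons]
      omega
  · omega

end PolyTime

end MultiColor

/-! ### The linear system of an input -/

namespace MultiColor
open Enc (enc)

namespace Input

variable (I : Input)

/-- The product of all denominators. -/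
def commonDen : ℕ := (I.fractions.flatten.flatten.map Prod.snd).prod

/-- The labels (item, color) of the columns. -/
def ids : List (ℕ × ℕ) := (List.range I.n).flatMap fun j => (List.range I.c).map fun r => (j, r)

/-- The coordinates of a vector, multiplied by the common denominator. -/
def entry (id : ℕ × ℕ) (i : Fin I.m) : ℤ :=
  if h : id.1 < I.n ∧ id.2 < I.c then
    (I.v ⟨id.1, h.1⟩ ⟨id.2, h.2⟩ i).num * (I.commonDen / (I.v ⟨id.1, h.1⟩ ⟨id.2, h.2⟩ i).den : ℕ)
  else 0

/-- The column of the system of equations with label `id`: the unit vector of the item, followed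
by the vector. -/
def col (id : ℕ × ℕ) : Fin (I.n + I.m) → ℤ :=
  Fin.append (fun i : Fin I.n => if (i : ℕ) = id.1 then 1 else 0) (I.entry id)

/-- All columns. -/
def columns : List (List ℤ) := I.ids.map fun id => List.ofFn (I.col id)

/-- The first tableau, all of whose basic columns are artificial. -/
def start : Tableau :=
  (1, List.replicate (I.n + I.m) none, List.replicate (I.n + I.m) 0, I.columns)

/-- The last tableau. -/
def final : Tableau := I.ids.foldl (fun s id => step id s) I.start

/-- The colors of all items. -/
def colors : List ℕ := (List.range I.n).map fun j => pickColor j I.final.2.1 I.final.2.2.1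

theorem length_fractions : I.fractions.length = I.n := by simp [fractions]

/-- As `n` and `c` are positive, the first item and its first vector exist; so `c` and `m` can be
read off as lengths although the input word does not state them. -/
theorem length_headD_fractions : (I.fractions.headD []).length = I.c := by
  have h : I.fractions.headD [] = I.fractions[0]'(by rw [length_fractions]; exact I.n_pos) := by
    rw [List.headD_eq_head?_getD, List.head?_eq_getElem?, List.getElem?_eq_getElem]
    rfl
  rw [h]
  simp [fractions]

theorem length_headD_headD_fractions : ((I.fractions.headD []).headD []).length = I.m := by
  have h : I.fractions.headD [] = I.fractions[0]'(by rw [length_fractions]; exact I.n_pos) := by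
    rw [List.headD_eq_head?_getD, List.head?_eq_getElem?, List.getElem?_eq_getElem]
    rfl
  have h' : (I.fractions.headD []).headD [] = (I.fractions.headD [])[0]'(by
      rw [length_headD_fractions]; exact I.c_pos) := by
    rw [List.headD_eq_head?_getD, List.head?_eq_getElem?, List.getElem?_eq_getElem]
    rfl
  rw [h']
  simp only [h]
  simp [fractions]

theorem polyTime_range_n : PolyTime fun I : Input => List.range I.n := by
  simpa only [length_fractions] using PolyTime.fractions.range_length

theorem polyTime_range_c : PolyTime fun I : Input => List.range I.c := by
  simpa only [length_headD_fractions] using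
    (PolyTime.fractions.headD (PolyTime.const [])).range_length

theorem polyTime_range_m : PolyTime fun I : Input => List.range I.m := by
  simpa only [length_headD_headD_fractions] using
    ((PolyTime.fractions.headD (PolyTime.const [])).headD (PolyTime.const [])).range_length

theorem polyTime_ids : PolyTime ids := by
  have h := polyTime_range_c
  exact PolyTime.flatMap (h := fun I j => (List.range I.c).map fun r => (j, r)) polyTime_range_n
    (PolyTime.map (l := fun p : Input × ℕ => List.range p.1.c) (h := fun p r => (p.2, r))
      (h.comp PolyTime.fst') (by fun_prop))

theorem polyTime_commonDen : PolyTime commonDen := by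
  have h := PolyTime.fractions
  have h' : PolyTime fun I : Input => I.fractions.flatten.flatten.map Prod.snd :=
    PolyTime.map (h := fun (_ : Input) (p : ℤ × ℕ) => p.2) h.flatten.flatten (by fun_prop)
  exact h'.list_prod

/-- This form refers only to the parsed lists and no longer to finite index types, so the closure
properties of `PolyTime` apply to it. -/
theorem columns_eq : I.columns = ((List.range I.n).zip I.fractions).flatMap fun p =>
    p.2.map fun w => ((List.range I.n).map fun i => if i = p.1 then (1 : ℤ) else 0) ++
      w.map fun q => q.1 * ((I.commonDen / q.2 : ℕ) : ℤ) := by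
  have h : (List.range I.n).zip I.fractions = List.ofFn fun j : Fin I.n => ((j : ℕ),
      List.ofFn fun r => List.ofFn fun i => ((I.v j r i).num, (I.v j r i).den)) := by
    refine List.ext_getElem (by simp [fractions]) fun k h₁ h₂ => ?_
    simp [fractions]
  have hn : ∀ k, List.range k = List.ofFn fun j : Fin k => (j : ℕ) := by
    intro k
    refine List.ext_getElem (by simp) fun k h₁ h₂ => ?_
    simp
  rw [h, columns, ids, hn, hn]
  simp only [List.flatMap_def, List.map_flatten, List.map_ofFn, Function.comp_def]
  congr 2
  funext j
  congr 1
  funext r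
  rw [col, List.ofFn_fin_append]
  congr 2
  funext i
  simp [entry]

theorem polyTime_columns : PolyTime columns := by
  have h₁ := polyTime_range_n
  have h₂ := PolyTime.fractions
  have h₃ := polyTime_commonDen
  have : PolyTime fun I : Input => ((List.range I.n).zip I.fractions).flatMap fun p =>
    p.2.map fun w => ((List.range I.n).map fun i => if i = p.1 then (1 : ℤ) else 0) ++
      w.map fun q => q.1 * ((I.commonDen / q.2 : ℕ) : ℤ) := by
    refine PolyTime.flatMap (h := fun I p => p.2.map fun w => ((List.range I.n).map fun i =>
      if i = p.1 then (1 : ℤ) else 0) ++ w.map fun q => q.1 * ((I.commonDen / q.2 : ℕ) : ℤ))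
      (h₁.zip h₂) ?_
    refine PolyTime.map (l := fun x : Input × ℕ × List (List (ℤ × ℕ)) => x.2.2) (h := fun x w =>
      ((List.range x.1.n).map fun i => if i = x.2.1 then (1 : ℤ) else 0) ++
      w.map fun q => q.1 * ((x.1.commonDen / q.2 : ℕ) : ℤ)) (by fun_prop) ?_
    refine PolyTime.append ?_ ?_
    · exact PolyTime.map (l := fun y : (Input × ℕ × List (List (ℤ × ℕ))) × List (ℤ × ℕ) =>
        List.range y.1.1.n) (h := fun y i => if i = y.1.2.1 then (1 : ℤ) else 0)
        (h₁.comp (by fun_prop)) (by fun_prop)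
    · refine PolyTime.map (l := fun y : (Input × ℕ × List (List (ℤ × ℕ))) × List (ℤ × ℕ) => y.2)
        (h := fun y q => q.1 * ((y.1.1.commonDen / q.2 : ℕ) : ℤ)) (by fun_prop) ?_
      have := h₃.comp (f := fun z : ((Input × ℕ × List (List (ℤ × ℕ))) × List (ℤ × ℕ)) × ℤ × ℕ =>
        z.1.1.1) (by fun_prop)
      fun_prop
  simpa only [← columns_eq] using this

theorem polyTime_replicate {β : Type} [Enc β] (b : β) :
    PolyTime fun I : Input => List.replicate (I.n + I.m) b := by
  have := PolyTime.map (h := fun _ _ => b) (polyTime_range_n.append polyTime_range_m) (by fun_prop)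
  simpa [List.map_const', ← List.replicate_add] using this

theorem polyTime_start : PolyTime start :=
  (PolyTime.const 1).pair ((polyTime_replicate _).pair ((polyTime_replicate _).pair
    polyTime_columns))

/-- A bound for the determinants that occur as entries of the tableaux. -/
def detBound : ℕ := ((List.range I.n ++ List.range I.m).map fun _ =>
  (I.n + I.m) * ((I.ids.length + 1) *
    ((I.columns.flatten.map fun z => (z.natAbs : ℤ)).sum.natAbs + 1))).prod

theorem polyTime_n : PolyTime fun I : Input => I.n := by
  simpa using polyTime_range_n.length

theorem polyTime_m : PolyTime fun I : Input => I.m := by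
  simpa using polyTime_range_m.length

/-- The algorithm never uses this number. Computing it in polynomial time is a way to show that its
binary length is polynomial. -/
theorem polyTime_detBound : PolyTime detBound := by
  have h₁ := polyTime_n
  have h₂ := polyTime_m
  have h₃ := polyTime_ids
  have h₀ : PolyTime fun I : Input => I.columns.flatten.map fun z => (z.natAbs : ℤ) :=
    PolyTime.map (h := fun (_ : Input) (z : ℤ) => (z.natAbs : ℤ)) polyTime_columns.flatten
      (by fun_prop)
  have h₄ := h₀.list_sum
  have h₅ : PolyTime fun I : Input => (I.n + I.m) * ((I.ids.length + 1) *
    ((I.columns.flatten.map fun z => (z.natAbs : ℤ)).sum.natAbs + 1)) := by fun_prop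
  have h₆ : PolyTime fun I : Input => (List.range I.n ++ List.range I.m).map fun _ =>
      (I.n + I.m) * ((I.ids.length + 1) *
        ((I.columns.flatten.map fun z => (z.natAbs : ℤ)).sum.natAbs + 1)) :=
    PolyTime.map (h := fun (I : Input) (_ : ℕ) => (I.n + I.m) * ((I.ids.length + 1) *
      ((I.columns.flatten.map fun z => (z.natAbs : ℤ)).sum.natAbs + 1)))
      (polyTime_range_n.append polyTime_range_m) (h₅.comp PolyTime.fst')
  exact h₆.list_prod

end Input

end MultiColor

/-! ### Pivot steps: Cramer's rule, ratio test and the invariant -/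

namespace MultiColor
open Matrix

section

variable {N : ℕ}

theorem updateCol_mulVec (B : Matrix (Fin N) (Fin N) ℤ) (p : Fin N) (a y : Fin N → ℤ) :
    B.updateCol p a *ᵥ y = B *ᵥ y + y p • (a - fun l => B l p) := by
  funext l
  have h : ∀ C : Matrix (Fin N) (Fin N) ℤ, (C *ᵥ y) l =
      C l p * y p + ∑ i ∈ Finset.univ.erase p, C l i * y i := fun C =>
    (Finset.add_sum_erase _ _ (Finset.mem_univ p)).symm
  rw [Pi.add_apply, h, h]
  have : ∑ i ∈ Finset.univ.erase p, B.updateCol p a l i * y i =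
      ∑ i ∈ Finset.univ.erase p, B l i * y i :=
    Finset.sum_congr rfl fun i hi => by
      rw [Matrix.updateCol_apply, if_neg (Finset.ne_of_mem_erase hi)]
  rw [this, Matrix.updateCol_self]
  simp
  ring

/-- Cramer's rule: multiply the equation by the adjugate of `B` and compare entries. -/
theorem mul_det_updateCol {B : Matrix (Fin N) (Fin N) ℤ} {D : ℤ} {u b : Fin N → ℤ}
    (h : B *ᵥ u = D • b) (i : Fin N) : D * (B.updateCol i b).det = B.det * u i := by
  have h₁ : B.cramer (D • b) = B.det • u := by
    rw [← h, cramer_eq_adjugate_mulVec, mulVec_mulVec, adjugate_mul, smul_mulVec, one_mulVec]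
  have h₂ := congrFun h₁ i
  rw [map_smul, Pi.smul_apply, cramer_apply] at h₂
  simpa using h₂

/-- When the common denominator is `|det B|`, the numerators are determinants up to sign. This
bounds all tableau entries, and it identifies the new denominator `|t p|` with the determinant of
the new basis. -/
theorem natAbs_det_updateCol {B : Matrix (Fin N) (Fin N) ℤ} {D : ℤ} {u b : Fin N → ℤ}
    (hD : 0 < D) (hB : |B.det| = D) (h : B *ᵥ u = D • b) (i : Fin N) :
    |(B.updateCol i b).det| = |u i| := by
  have h₁ := congrArg abs (mul_det_updateCol h i)
  rw [abs_mul, abs_mul, hB, abs_of_pos hD] at h₁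
  exact mul_left_cancel₀ hD.ne' h₁

/-- The effect of a pivot step on a solution of a system of linear equations. -/
theorem exists_pivot {B : Matrix (Fin N) (Fin N) ℤ} {D : ℤ} {t a : Fin N → ℤ} {p : Fin N}
    (hD : 0 < D) (hB : |B.det| = D) (ht : B *ᵥ t = D • a) (hp : t p ≠ 0) {u b : Fin N → ℤ}
    (hu : B *ᵥ u = D • b) :
    ∃ w : Fin N → ℤ, B.updateCol p a *ᵥ w = |t p| • b ∧
      ∀ i, (if t p < 0 then -D else D) * w i =
        u i * t p - (t i - D * if i = p then 1 else 0) * u p := by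
  have hdet := mul_det_updateCol ht p
  obtain ⟨ε, hε, hε'⟩ : ∃ ε : ℤ, ε * ε = 1 ∧ B.det = ε * D := by
    rcases abs_choice B.det with h | h
    · exact ⟨1, by ring, by rw [← hB, h]; ring⟩
    · exact ⟨-1, by ring, by rw [← hB, h]; ring⟩
  have hdet' : (B.updateCol p a).det = ε * t p := by
    refine mul_left_cancel₀ hD.ne' ?_
    rw [hdet, hε']
    ring
  have hne : (B.updateCol p a).det ≠ 0 := by
    rw [hdet']
    refine mul_ne_zero (fun h => ?_) hp
    simp [h] at hε
  -- The new numerators are defined by Cramer's rule, which makes them integers from the start.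
  set w := ε • (B.updateCol p a).cramer b with hw
  have hw' : B.updateCol p a *ᵥ w = t p • b := by
    rw [hw, mulVec_smul, mulVec_cramer, hdet', smul_smul, ← mul_assoc, hε, one_mul]
  -- This is the elimination formula before the division by `D`. Both `D • w` and `y` solve the same
  -- system with a nonsingular matrix, so they agree; hence the division is exact.
  set y : Fin N → ℤ := t p • u - u p • (t - D • Pi.single p 1) with hy
  have hyp : y p = D * u p := by simp [hy]; ring
  have hy' : B.updateCol p a *ᵥ y = (D * t p) • b := by
    rw [updateCol_mulVec, hyp, hy, mulVec_sub, mulVec_smul, mulVec_smul, mulVec_sub, mulVec_smul,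
      hu, ht, mulVec_single_one]
    funext l
    simp [Matrix.col]
    ring
  have hDw : D • w = y := by
    rw [← sub_eq_zero]
    refine eq_zero_of_mulVec_eq_zero hne ?_
    rw [mulVec_sub, mulVec_smul, hw', hy', smul_smul, sub_self]
  have hval : ∀ i, D * w i = u i * t p - (t i - D * if i = p then 1 else 0) * u p := by
    intro i
    have := congrFun hDw i
    simp only [hy, Pi.smul_apply, Pi.sub_apply, smul_eq_mul, Pi.single_apply] at this
    rw [this]
    ring
  -- The sign is changed if necessary so that the new denominator is the positive number `|t p|`.
  by_cases hneg : t p < 0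
  · refine ⟨-w, ?_, fun i => ?_⟩
    · rw [mulVec_neg, hw', abs_of_neg hneg, neg_smul]
    · rw [if_pos hneg, ← hval, Pi.neg_apply]
      ring
  · refine ⟨w, ?_, fun i => ?_⟩
    · rw [hw', abs_of_nonneg (not_lt.1 hneg)]
    · rw [if_neg hneg, ← hval]

theorem zipWith_ofFn {α β γ : Type} (f : α → β → γ) (a : Fin N → α) (b : Fin N → β) :
    List.zipWith f (List.ofFn a) (List.ofFn b) = List.ofFn fun i => f (a i) (b i) :=
  List.ext_getElem (by simp) fun k h₁ h₂ => by simp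

theorem zip_ofFn {α β : Type} (a : Fin N → α) (b : Fin N → β) :
    (List.ofFn a).zip (List.ofFn b) = List.ofFn fun i => (a i, b i) := zipWith_ofFn _ a b

theorem unitVec_ofFn (t : Fin N → ℤ) (p : Fin N) :
    unitVec (List.ofFn t) p = List.ofFn fun i => if i = p then 1 else 0 :=
  List.ext_getElem (by simp [unitVec]) fun k h₁ h₂ => by simp [unitVec, Fin.ext_iff]

theorem dot_ofFn (p : Fin N) (u : Fin N → ℤ) :
    dot (List.ofFn fun i => if i = p then 1 else 0) (List.ofFn u) = u p := by
  rw [dot, zipWith_ofFn, List.sum_ofFn]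
  simp

/-- Bounds are fractions with positive denominators and are compared by cross-multiplication. -/
theorem foldr_selectStep (l : List (Option (ℤ × ℤ))) (hl : ∀ q, some q ∈ l → 0 < q.2) :
    ((l.foldr selectStep (none, 0)).1 = none ∧ ∀ k ∈ l, k = none) ∨
      ∃ q, (l.foldr selectStep (none, 0)).1 = some q ∧
        l[(l.foldr selectStep (none, 0)).2]? = some (some q) ∧
        ∀ q', some q' ∈ l → q.1 * q'.2 ≤ q'.1 * q.2 := by
  induction l with
  | nil => left; simp
  | cons k l ih =>
    have ih := ih fun q hq => hl q (by simp [hq])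
    rw [List.foldr_cons]
    generalize l.foldr selectStep (none, 0) = s at ih
    cases k with
    | none =>
      rcases ih with ⟨h₁, h₂⟩ | ⟨q, h₁, h₂, h₃⟩
      · left
        simpa [selectStep, h₁] using h₂
      · right
        exact ⟨q, by simpa [selectStep] using h₁, by simpa [selectStep] using h₂,
          by simpa using h₃⟩
    | some r =>
      right
      rcases ih with ⟨h₁, h₂⟩ | ⟨q, h₁, h₂, h₃⟩
      · refine ⟨r, by simp [selectStep, h₁], by simp [selectStep, h₁], fun q' hq' => ?_⟩
        rcases List.mem_cons.1 hq' with h | h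
        · obtain rfl := Option.some.inj h
          exact le_rfl
        · simpa using h₂ _ h
      · by_cases h : r.1 * q.2 < q.1 * r.2
        · refine ⟨r, by simp [selectStep, h₁, h], by simp [selectStep, h₁, h], fun q' hq' => ?_⟩
          rcases List.mem_cons.1 hq' with h' | h'
          · obtain rfl := Option.some.inj h'
            exact le_rfl
          · have h₄ := h₃ q' h'
            have h₅ := hl r (by simp)
            have h₆ := hl q' (by simp [h'])
            have h₇ := hl q (by simp [List.mem_of_getElem? h₂])
            -- Transitivity of the order of fractions: multiplying by the denominator of `q` lets
            -- the two cross-multiplied inequalities be combined.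
            refine le_of_mul_le_mul_right ?_ h₇
            nlinarith
        · refine ⟨q, by simp [selectStep, h₁, h], by simp [selectStep, h₁, h, h₂],
            fun q' hq' => ?_⟩
          rcases List.mem_cons.1 hq' with h' | h'
          · obtain rfl := Option.some.inj h'
            linarith
          · exact h₃ q' h'

/-- The properties of the tableau after the columns with labels in `done` have been treated and
before the columns with labels in `rest` are treated: the rows belong to a basis `B` of columns,
in which all columns are expressed with the common denominator `s.1`. -/
def Valid (col : ℕ × ℕ → Fin N → ℤ) (done rest : List (ℕ × ℕ)) (s : Tableau) : Prop :=
  ∃ (B : Matrix (Fin N) (Fin N) ℤ) (τ : Fin N → Option (ℕ × ℕ)) (ξ : Fin N → ℤ),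
    0 < s.1 ∧ |B.det| = s.1 ∧ s.2.1 = List.ofFn τ ∧ s.2.2.1 = List.ofFn ξ ∧
    B *ᵥ ξ = s.1 • (done.map col).sum ∧ (∀ i, 0 ≤ ξ i) ∧ (∀ i, τ i = none → ξ i = 0) ∧
    (∀ i, τ i = none → ∀ l, |B l i| ≤ 1) ∧
    (∀ i id, τ i = some id → id ∈ done ∧ ∀ l, B l i = col id l) ∧
    List.Forall₂ (fun id u => ∃ t, u = List.ofFn t ∧ B *ᵥ t = s.1 • col id) rest s.2.2.2

/-- For `0 ≤ λ ≤ 1`, the new sum of columns is represented by the coefficients `(ξ + λ t) / D` on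
the basis together with weight `1 - λ` on the new column. If `λ = 1` keeps all coefficients
nonnegative and the artificial ones zero, the basis stays. Otherwise `λ` is the smallest bound, and
the new column replaces the row attaining it. An artificial row with `t i ≠ 0` imposes the bound 0.
-/
theorem Valid.step {col : ℕ × ℕ → Fin N → ℤ} {done rest : List (ℕ × ℕ)} {id : ℕ × ℕ}
    {s : Tableau} (h : Valid col done (id :: rest) s) :
    Valid col (done ++ [id]) rest (step id s) := by
  obtain ⟨D, tags, x, cols⟩ := s
  obtain ⟨B, τ, ξ, hD, hB, hτ, hξ, hBξ, hpos, hart, hone, hcol, hrest⟩ := h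
  simp only at hD hB hτ hξ hBξ hrest
  subst hτ hξ
  obtain ⟨_, cols, ⟨t, rfl, ht⟩, hcols, rfl⟩ := List.forall₂_cons_left_iff.1 hrest
  have hsum : ((done ++ [id]).map col).sum = (done.map col).sum + col id := by simp
  have hy : B *ᵥ (ξ + t) = D • ((done ++ [id]).map col).sum := by
    rw [mulVec_add, hBξ, ht, hsum, smul_add]
  have hkeys : List.zipWith pivotKey (List.ofFn τ) ((List.ofFn ξ).zip (List.ofFn t)) =
      List.ofFn fun i => pivotKey (τ i) (ξ i, t i) := by rw [zip_ofFn, zipWith_ofFn]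
  have hkey_pos : ∀ i q, pivotKey (τ i) (ξ i, t i) = some q → 0 < q.2 := by
    intro i q hq
    unfold pivotKey at hq
    split_ifs at hq with h₁ h₂ h₃ <;> obtain rfl := Option.some.inj hq
    · norm_num
    · have := hpos i
      simp only at h₃ ⊢
      linarith
  have hsel := foldr_selectStep (List.ofFn fun i => pivotKey (τ i) (ξ i, t i)) fun q hq => by
    obtain ⟨i, hi⟩ := List.mem_ofFn.1 hq
    exact hkey_pos i q hi
  unfold MultiColor.step select
  simp only [List.headD_cons, List.tail_cons, hkeys, zipWith_ofFn]
  generalize (List.ofFn fun i => pivotKey (τ i) (ξ i, t i)).foldr selectStep (none, 0) = σ at hsel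
  rcases hsel with ⟨h₁, h₂⟩ | ⟨q, h₁, h₂, h₃⟩
  · rw [if_pos (by simp [h₁])]
    have hk : ∀ i, pivotKey (τ i) (ξ i, t i) = none := fun i => h₂ _ (List.mem_ofFn.2 ⟨i, rfl⟩)
    refine ⟨B, τ, ξ + t, hD, hB, rfl, rfl, hy, fun i => ?_, fun i hi => ?_, hone,
      fun i id' hi => ?_, hcols⟩
    · have hki := hk i
      unfold pivotKey at hki
      split_ifs at hki with h₁ h₂ h₃
      · simp only at h₂
        simpa [h₂] using hpos i
      · simpa using h₃
    · have hki := hk i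
      unfold pivotKey at hki
      rw [hi] at hki
      simp only [Option.isNone_none, if_true, ite_eq_left_iff, reduceCtorEq, imp_false,
        not_not] at hki
      simp [hart i hi, hki]
    · exact ⟨by simp [(hcol i id' hi).1], (hcol i id' hi).2⟩
  · rw [if_neg (by simp [h₁])]
    obtain ⟨p, hp, hpq⟩ : ∃ p : Fin N, (p : ℕ) = σ.2 ∧ pivotKey (τ p) (ξ p, t p) = some q := by
      rw [List.getElem?_ofFn] at h₂
      split_ifs at h₂ with hlt
      exact ⟨⟨σ.2, hlt⟩, rfl, Option.some.inj h₂⟩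
    have hmin : ∀ i q', pivotKey (τ i) (ξ i, t i) = some q' → q.1 * q'.2 ≤ q'.1 * q.2 :=
      fun i q' hi => h₃ q' (List.mem_ofFn.2 ⟨i, hi⟩)
    -- An artificial row imposes a bound only for a nonzero entry; any other row only if `ξ p + t p
    -- < 0`, while `ξ p ≥ 0`.
    have htp : t p ≠ 0 := by
      intro h0
      unfold pivotKey at hpq
      split_ifs at hpq with h₁ h₂
      have := hpos p
      simp only at h₂
      omega
    rw [← hp, unitVec_ofFn, pivot, dot_ofFn]
    simp only [zipWith_ofFn]
    have hred : ∀ u b : Fin N → ℤ, B *ᵥ u = D • b → ∃ w : Fin N → ℤ,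
        B.updateCol p (col id) *ᵥ w = |t p| • b ∧ reduceCol (if t p < 0 then -D else D) (t p)
          (List.ofFn fun i => t i - D * if i = p then 1 else 0)
          (List.ofFn fun i => if i = p then 1 else 0) (List.ofFn u) = List.ofFn w ∧
        ∀ i, (if t p < 0 then -D else D) * w i =
          u i * t p - (t i - D * if i = p then 1 else 0) * u p := by
      intro u b hu
      obtain ⟨w, hw, hw'⟩ := exists_pivot hD hB ht htp hu
      refine ⟨w, hw, ?_, hw'⟩
      rw [reduceCol, dot_ofFn, zipWith_ofFn]
      congr 1
      funext i
      -- The numerator is a multiple of `± D`, so the truncated division is exact.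
      rw [← hw', Int.mul_tdiv_cancel_left]
      split_ifs <;> omega
    obtain ⟨w, hw, hwl, hwi⟩ := hred (ξ + t) _ hy
    -- The terms `t i * t p` cancel: the full step contained in `ξ + t` is undone outside the pivot
    -- row.
    have hwi' : ∀ i, i ≠ p → (if t p < 0 then -D else D) * w i = ξ i * t p - t i * ξ p := by
      intro i hi
      rw [hwi, if_neg hi, Pi.add_apply, Pi.add_apply]
      ring
    have hwp : (if t p < 0 then -D else D) * w p = D * (ξ p + t p) := by
      rw [hwi, if_pos rfl, Pi.add_apply]
      ring
    have hsplit : (τ p = none ∧ q = (0, 1) ∧ ξ p = 0) ∨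
        (τ p ≠ none ∧ q = (ξ p, -t p) ∧ ξ p + t p < 0 ∧ t p < 0) := by
      unfold pivotKey at hpq
      split_ifs at hpq with h₁ h₂
      · left
        have : τ p = none := by simpa using h₁
        exact ⟨this, (Option.some.inj hpq).symm, hart p this⟩
      · right
        have := hpos p
        simp only at h₂
        exact ⟨by simpa using h₁, (Option.some.inj hpq).symm, h₂, by linarith⟩
    -- Either the entry of the artificial row is 0, or its bound 0 took part in the comparison; then
    -- the smallest bound is 0 and `ξ p = 0`.
    have hzero : ∀ i, i ≠ p → τ i = none → w i = 0 := by
      intro i hi hτi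
      have hi' := hwi' i hi
      have hne : (if t p < 0 then -D else D) ≠ 0 := by split_ifs <;> omega
      suffices t i * ξ p = 0 by
        rw [hart i hτi, zero_mul, this, sub_zero] at hi'
        exact (mul_eq_zero.1 hi').resolve_left hne
      by_cases hti : t i = 0
      · rw [hti, zero_mul]
      · have hm := hmin i (0, 1) (by simp [pivotKey, hτi, hti])
        have := hpos p
        rcases hsplit with ⟨_, _, h⟩ | ⟨_, rfl, _⟩
        · rw [h, mul_zero]
        · simp only [mul_one, zero_mul] at hm
          rw [le_antisymm hm this, mul_zero]
    have hnonneg : ∀ i, 0 ≤ w i := by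
      intro i
      by_cases hi : i = p
      · subst hi
        rcases hsplit with ⟨_, _, h⟩ | ⟨_, _, h, h'⟩
        · rw [h, zero_add] at hwp
          split_ifs at hwp with hneg <;> nlinarith
        · rw [if_pos h'] at hwp
          nlinarith
      · have hi' := hwi' i hi
        rcases hsplit with ⟨_, _, h⟩ | ⟨_, rfl, h, h'⟩
        · rw [h, mul_zero, sub_zero] at hi'
          have := hpos i
          split_ifs at hi' with hneg <;> nlinarith
        · rw [if_pos h'] at hi'
          have h₄ := hpos i
          have h₅ := hpos p
          by_cases hτi : τ i = none
          · exact (hzero i hi hτi).ge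
          -- For a row with a bound this is the minimality of the chosen one. For `t i ≥ 0` the
          -- signs suffice. In the remaining case the ratio `ξ i / -t i` is at least 1, whereas `ξ p
          -- / -t p` is below 1.
          · have key : t i * -ξ p ≤ ξ i * -t p := by
              by_cases hlt : ξ i + t i < 0
              · have := hmin i (ξ i, -t i) (by
                  unfold pivotKey
                  rw [if_neg (by simpa using hτi), if_pos hlt])
                simp only at this
                linarith
              · by_cases hti : 0 ≤ t i
                · nlinarith
                · nlinarith
            nlinarith
    refine ⟨B.updateCol p (col id), fun i => if i = p then some id else τ i, w, by simpa using htp,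
      ?_, ?_, hwl, ?_, hnonneg, fun i hi => ?_, fun i hi l => ?_, fun i id' hi => ?_, ?_⟩
    · rw [natAbs_det_updateCol hD hB ht p]
      simp
    · refine congrArg List.ofFn (funext fun i => ?_)
      by_cases hi : i = p <;> simp [hi]
    · rw [hw]
      simp
    · dsimp only at hi
      split_ifs at hi with hip
      exact hzero i hip hi
    · dsimp only at hi
      split_ifs at hi with hip
      rw [Matrix.updateCol_apply, if_neg hip]
      exact hone i hi l
    · dsimp only at hi
      split_ifs at hi with hip
      · obtain rfl := Option.some.inj hi
        refine ⟨by simp, fun l => ?_⟩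
        rw [Matrix.updateCol_apply, if_pos hip]
      · refine ⟨by simp [(hcol i id' hi).1], fun l => ?_⟩
        rw [Matrix.updateCol_apply, if_neg hip]
        exact (hcol i id' hi).2 l
    · refine List.forall₂_map_right_iff.2 (hcols.imp fun id' u hu => ?_)
      obtain ⟨u, rfl, hu⟩ := hu
      obtain ⟨w', hw', hl, _⟩ := hred u _ hu
      exact ⟨w', hl, by rw [hw']; simp⟩

theorem Valid.foldl {col : ℕ × ℕ → Fin N → ℤ} {done rest rest' : List (ℕ × ℕ)} {s : Tableau}
    (h : Valid col done (rest ++ rest') s) :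
    Valid col (done ++ rest) rest' (rest.foldl (fun s id => MultiColor.step id s) s) := by
  induction rest generalizing done s with
  | nil => simpa using h
  | cons id rest ih =>
    have := ih (Valid.step h)
    simpa using this

end

end MultiColor

/-! ### Polynomial bounds for the tableaux -/

namespace MultiColor
open Matrix

namespace Input

variable (I : Input)

theorem mem_ids {id : ℕ × ℕ} : id ∈ I.ids ↔ id.1 < I.n ∧ id.2 < I.c := by
  obtain ⟨j, r⟩ := id
  simp [ids]

/-- The basis is the identity matrix with denominator 1, so each column is its own coefficient
vector, and the empty sum has coefficients 0. -/
theorem valid_start : Valid I.col [] I.ids I.start := by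
  refine ⟨1, fun _ => none, 0, one_pos, by simp [start], ?_, ?_, by simp, fun _ => le_rfl,
    fun _ _ => rfl, fun i _ l => ?_, fun _ _ h => by simp at h, ?_⟩
  · simp [start, List.ofFn_const]
  · simp only [start]
    exact (List.ofFn_const _ _).symm
  · rw [Matrix.one_apply]
    split_ifs <;> simp
  · simp only [start, columns]
    rw [List.forall₂_map_right_iff]
    exact List.forall₂_same.2 fun id _ => ⟨I.col id, rfl, by simp⟩

theorem valid_foldl {l : List (ℕ × ℕ)} (hl : l <+: I.ids) :
    ∃ l', l ++ l' = I.ids ∧ Valid I.col l l' (l.foldl (fun s id => step id s) I.start) := by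
  obtain ⟨l', h⟩ := hl
  refine ⟨l', h, ?_⟩
  have := I.valid_start
  rw [← h] at this
  simpa using this.foldl

/-- A bound for the entries of all columns. -/
def entryBound : ℕ := (I.columns.flatten.map fun z => (z.natAbs : ℤ)).sum.natAbs + 1

theorem detBound_eq :
    I.detBound = ((I.n + I.m) * ((I.ids.length + 1) * I.entryBound)) ^ (I.n + I.m) := by
  simp [detBound, entryBound, List.map_const', List.prod_replicate, pow_add]

theorem abs_col_le {id : ℕ × ℕ} (h : id ∈ I.ids) (l : Fin (I.n + I.m)) :
    |I.col id l| ≤ I.entryBound := by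
  have hmem : ((I.col id l).natAbs : ℤ) ∈ I.columns.flatten.map fun z => (z.natAbs : ℤ) := by
    refine List.mem_map.2 ⟨I.col id l, List.mem_flatten.2 ⟨List.ofFn (I.col id), ?_, ?_⟩, rfl⟩
    · exact List.mem_map.2 ⟨id, h, rfl⟩
    · exact List.mem_ofFn.2 ⟨l, rfl⟩
  have := List.single_le_sum (fun x hx => by
    obtain ⟨z, _, rfl⟩ := List.mem_map.1 hx
    exact Int.natCast_nonneg _) _ hmem
  rw [Int.natCast_natAbs] at this
  rw [entryBound, Nat.cast_succ]
  exact this.trans (Int.le_natAbs.trans (by omega))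

theorem abs_sum_col_le {l : List (ℕ × ℕ)} (h : ∀ id ∈ l, id ∈ I.ids) (k : Fin (I.n + I.m)) :
    |(l.map I.col).sum k| ≤ l.length * I.entryBound := by
  induction l with
  | nil => simp
  | cons id l ih =>
    have h₁ := ih fun id' h' => h id' (by simp [h'])
    have h₂ := I.abs_col_le (h id (by simp)) k
    rw [List.map_cons, List.sum_cons, Pi.add_apply, List.length_cons]
    push_cast
    have := abs_add_le (I.col id k) ((l.map I.col).sum k)
    linarith

/-- Leibniz's formula with `N! ≤ N ^ N`. The factor `I.ids.length + 1` leaves room for a column that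
is a sum of input columns, as the right-hand side of the system is. -/
theorem abs_det_le {A : Matrix (Fin (I.n + I.m)) (Fin (I.n + I.m)) ℤ}
    (h : ∀ k l, |A k l| ≤ (I.ids.length + 1) * I.entryBound) : |A.det| ≤ I.detBound := by
  have h₁ := Matrix.det_le (abv := AbsoluteValue.abs) h
  rw [Fintype.card_fin, nsmul_eq_mul] at h₁
  refine h₁.trans ?_
  rw [detBound_eq]
  have h₂ : ((I.n + I.m).factorial : ℤ) ≤ (((I.n + I.m) ^ (I.n + I.m) : ℕ) : ℤ) := by
    exact_mod_cast Nat.factorial_le_pow (I.n + I.m)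
  have h₃ : (0 : ℤ) ≤ ((I.ids.length + 1) * I.entryBound) ^ (I.n + I.m) := by positivity
  have h₄ := mul_le_mul_of_nonneg_right h₂ h₃
  push_cast at h₄ ⊢
  rw [mul_pow ((I.n : ℤ) + I.m)]
  exact h₄

theorem abs_le_detBound {B : Matrix (Fin (I.n + I.m)) (Fin (I.n + I.m)) ℤ} {D : ℤ}
    (hD : 0 < D) (hB : |B.det| = D) (hB' : ∀ k l, |B k l| ≤ (I.ids.length + 1) * I.entryBound)
    {u b : Fin (I.n + I.m) → ℤ} (h : B *ᵥ u = D • b)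
    (hb : ∀ k, |b k| ≤ (I.ids.length + 1) * I.entryBound) (i : Fin (I.n + I.m)) :
    |u i| ≤ I.detBound := by
  rw [← natAbs_det_updateCol hD hB h i]
  refine I.abs_det_le fun k l => ?_
  rw [Matrix.updateCol_apply]
  split_ifs
  · exact hb k
  · exact hB' k l

/-- The denominator is a determinant, and by Cramer's rule so are, up to sign, all entries of the
solution and of the untreated columns; the matrices have entries from artificial columns, input
columns or a sum of input columns. The summands account for the denominator, the labels, the
solution, the remaining columns and the pairings. -/
theorem size_le_of_valid {l l' : List (ℕ × ℕ)} {s : Tableau} (h : l ++ l' = I.ids)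
    (hs : Valid I.col l l' s) :
    size s ≤ (4 * size I.detBound + 5) + ((I.n + I.m) * (size I.ids + 3) + 1) +
      ((I.n + I.m) * (4 * size I.detBound + 6) + 1) +
      (size I.ids * ((I.n + I.m) * (4 * size I.detBound + 6) + 2) + 1) + 3 := by
  obtain ⟨D, tags, x, cols⟩ := s
  obtain ⟨B, τ, ξ, hD, hB, hτ, hξ, hBξ, -, -, hone, hcol, hrest⟩ := hs
  simp only at hD hB hτ hξ hBξ hrest
  subst hτ hξ
  have hle : (I.entryBound : ℤ) ≤ (I.ids.length + 1) * I.entryBound :=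
    le_mul_of_one_le_left (by positivity) (by omega)
  have hpos : (1 : ℤ) ≤ I.entryBound := by exact_mod_cast Nat.le_add_left 1 _
  have hB' : ∀ k l, |B k l| ≤ (I.ids.length + 1) * I.entryBound := by
    intro k i
    cases hi : τ i with
    | none => exact (hone i hi k).trans (hpos.trans hle)
    | some id =>
      rw [(hcol i id hi).2]
      exact (I.abs_col_le (by rw [← h]; simp [(hcol i id hi).1]) k).trans hle
  have hint : ∀ z : ℤ, |z| ≤ I.detBound → size z ≤ 4 * size I.detBound + 5 := by
    intro z hz
    have h₁ := size_int_le z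
    have h₂ := Nat.size_le_size (show z.natAbs ≤ I.detBound by
      rw [← Int.natCast_natAbs] at hz; exact_mod_cast hz)
    have h₃ := natSize_le_size I.detBound
    omega
  have hvec : ∀ u b : Fin (I.n + I.m) → ℤ, B *ᵥ u = D • b →
      (∀ k, |b k| ≤ (I.ids.length + 1) * I.entryBound) →
      size (List.ofFn u) ≤ (I.n + I.m) * (4 * size I.detBound + 6) + 1 := by
    intro u b hu hb
    have : size (List.ofFn u) ≤ _ := size_le_of_forall (k := 4 * size I.detBound + 5) fun z hz => by
      obtain ⟨i, rfl⟩ := List.mem_ofFn.1 hz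
      exact hint _ (I.abs_le_detBound hD hB hB' hu hb i)
    rwa [List.length_ofFn] at this
  have h₁ : size D ≤ 4 * size I.detBound + 5 := by
    refine hint D ?_
    rw [← hB, abs_abs]
    exact I.abs_det_le hB'
  have h₂ : size (List.ofFn τ) ≤ (I.n + I.m) * (size I.ids + 3) + 1 := by
    have : size (List.ofFn τ) ≤ _ := size_le_of_forall (k := size I.ids + 2) fun e he => by
      obtain ⟨i, rfl⟩ := List.mem_ofFn.1 he
      cases hi : τ i with
      | none => exact (show size (none : Option (ℕ × ℕ)) = 1 from rfl).le.trans (by omega)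
      | some id =>
        have h₁ := size_mem_le (show id ∈ I.ids by rw [← h]; simp [(hcol i id hi).1])
        have h₂ : size (some id) = size id + 1 + 1 := by
          rw [show size (some id) = size [id] from rfl, size_cons, size_nil]
        omega
    rwa [List.length_ofFn] at this
  have h₃ : size (List.ofFn ξ) ≤ (I.n + I.m) * (4 * size I.detBound + 6) + 1 := by
    refine hvec ξ _ hBξ fun k => ?_
    refine (I.abs_sum_col_le (fun id hid => by rw [← h]; simp [hid]) k).trans ?_
    refine mul_le_mul_of_nonneg_right ?_ (by positivity)
    rw [← h, List.length_append]
    push_cast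
    omega
  have h₄ : size cols ≤ size I.ids * ((I.n + I.m) * (4 * size I.detBound + 6) + 2) + 1 := by
    have h₁ : size cols ≤ cols.length * ((I.n + I.m) * (4 * size I.detBound + 6) + 2) + 1 :=
      size_le_of_forall (k := (I.n + I.m) * (4 * size I.detBound + 6) + 1) fun u hu => by
        obtain ⟨k, hk, rfl⟩ := List.mem_iff_getElem.1 hu
        have hk' : k < l'.length := by rw [hrest.length_eq]; exact hk
        obtain ⟨t, ht, ht'⟩ := hrest.get hk' hk
        simp only [List.get_eq_getElem] at ht ht'
        rw [ht]
        exact hvec t _ ht' fun i =>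
          (I.abs_col_le (by rw [← h]; simp) i).trans hle
    have h₂ : cols.length ≤ size I.ids := by
      have := length_le_size I.ids
      rw [← hrest.length_eq]
      rw [← h, List.length_append] at this
      rw [← h]
      omega
    have h₃ := Nat.mul_le_mul_right ((I.n + I.m) * (4 * size I.detBound + 6) + 2) h₂
    omega
  rw [size_pair, size_pair, size_pair]
  omega

theorem polyTime_final : PolyTime final := by
  obtain ⟨r₁, h₁⟩ := polyTime_detBound.size_le
  obtain ⟨r₂, h₂⟩ := polyTime_ids.size_le
  -- A list of `n + m` units has size at least `n + m`, so `r₃` bounds the number of rows.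
  obtain ⟨r₃, h₃⟩ := (polyTime_replicate ()).size_le
  refine PolyTime.foldl (h := fun p => step p.2.2 p.2.1) polyTime_ids polyTime_start
    (PolyTime.step.comp (f := fun p : Input × Tableau × ℕ × ℕ => (p.2.2, p.2.1)) (by fun_prop))
    ((4 * r₁ + 5) + (r₃ * (r₂ + 3) + 1) + (r₃ * (4 * r₁ + 6) + 1) +
      (r₂ * (r₃ * (4 * r₁ + 6) + 2) + 1) + 3) fun I l hl => ?_
  obtain ⟨l', h, hv⟩ := I.valid_foldl hl
  refine (I.size_le_of_valid h hv).trans ?_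
  have h₃' : I.n + I.m ≤ r₃.eval (size I) := by
    simpa using (length_le_size _).trans (h₃ I)
  have h₁' := h₁ I
  have h₂' := h₂ I
  simp only [Polynomial.eval_add, Polynomial.eval_mul, Polynomial.eval_ofNat, Polynomial.eval_one]
  gcongr

theorem polyTime_colors : PolyTime colors := by
  have h := polyTime_final
  exact PolyTime.map (h := fun I j => pickColor j I.final.2.1 I.final.2.2.1) polyTime_range_n
    (PolyTime.pickColor (by fun_prop) (by fun_prop) (by fun_prop))

theorem valid_final : Valid I.col I.ids [] I.final := by
  obtain ⟨l', h, hv⟩ := I.valid_foldl List.prefix_rfl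
  obtain rfl : l' = [] := by simpa using h
  exact hv

end Input

end MultiColor

/-! ### Rounding a sparse solution -/

namespace MultiColor

/-- If the weights of the labels of each item add up to `1` and there are at most `n + m` labels,
then replacing the weighted means of the items by the values of single labels with positive weight
changes the sum by at most `2 * m * M`. -/
theorem abs_sum_sub_sum_le {ι : Type} [Fintype ι] (J : ι → Option (ℕ × ℕ)) (y : ι → ℚ) (n m : ℕ)
    (hcard : Fintype.card ι ≤ n + m) (hy : ∀ i, 0 ≤ y i) (hnone : ∀ i, J i = none → y i = 0)
    (hlt : ∀ i id, J i = some id → id.1 < n)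
    (hsum : ∀ j < n, ∑ i, (if (J i).map Prod.fst = some j then y i else 0) = 1) (χ : ℕ → ℕ)
    (hχ : ∀ j < n, ∃ i, J i = some (j, χ j) ∧ 0 < y i) (f : ℕ × ℕ → ℚ) (M : ℚ)
    (hf : ∀ i id, J i = some id → |f id| ≤ M) (hM : 0 ≤ M) :
    |∑ i, y i * (J i).elim 0 f - ∑ j ∈ Finset.range n, f (j, χ j)| ≤ 2 * m * M := by
  classical
  -- The basis rows that give positive weight to item `j`. These sets are disjoint, and every
  -- positive weight belongs to one of them.
  let S : ℕ → Finset ι := fun j =>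
    Finset.univ.filter fun i => (J i).map Prod.fst = some j ∧ 0 < y i
  have hS : ∀ j i, i ∈ S j ↔ (J i).map Prod.fst = some j ∧ 0 < y i := fun j i => by simp [S]
  have hdisj : (Finset.range n : Set ℕ).PairwiseDisjoint S := by
    intro j _ j' _ hjj'
    refine Finset.disjoint_left.2 fun i hi hi' => hjj' ?_
    exact Option.some.inj (((hS _ _).1 hi).1.symm.trans ((hS _ _).1 hi').1)
  have hsplit : ∀ g : ι → ℚ, ∑ i, y i * g i = ∑ j ∈ Finset.range n, ∑ i ∈ S j, y i * g i := by
    intro g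
    rw [← Finset.sum_biUnion hdisj]
    symm
    refine Finset.sum_subset (Finset.subset_univ _) fun i _ hi => ?_
    rcases (hy i).eq_or_lt with h | h
    · rw [← h, zero_mul]
    · exfalso
      refine hi ?_
      cases hJ : J i with
      | none => exact absurd (hnone i hJ) h.ne'
      | some id =>
        exact Finset.mem_biUnion.2 ⟨id.1, Finset.mem_range.2 (hlt i id hJ),
          (hS _ _).2 ⟨by rw [hJ]; rfl, h⟩⟩
  have hone : ∀ j < n, ∑ i ∈ S j, y i = 1 := by
    intro j hj
    rw [← hsum j hj, ← Finset.sum_filter]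
    refine Finset.sum_subset (fun i hi => ?_) fun i hi hi' => ?_
    · simpa using ((hS _ _).1 hi).1
    · by_contra h
      exact hi' ((hS _ _).2 ⟨by simpa using hi, lt_of_le_of_ne (hy i) (Ne.symm h)⟩)
  have herr : ∀ j < n, |∑ i ∈ S j, y i * (J i).elim 0 f - f (j, χ j)| ≤
      2 * M * (((S j).card : ℚ) - 1) := by
    intro j hj
    obtain ⟨i₀, hi₀, hpos⟩ := hχ j hj
    have hmem : i₀ ∈ S j := (hS _ _).2 ⟨by rw [hi₀]; rfl, hpos⟩
    have hF : ∀ i ∈ S j, |(J i).elim 0 f| ≤ M := by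
      intro i _
      cases hJ : J i with
      | none => simpa using hM
      | some id => exact hf i id hJ
    -- A single positive weight equals 1 and belongs to the chosen color, so there is no error. With
    -- at least two, the mean and the chosen value are both at most `M` in absolute value, and `2 *
    -- M ≤ 2 * M * (card - 1)`.
    rcases (Nat.succ_le_of_lt (Finset.card_pos.2 ⟨i₀, hmem⟩)).eq_or_lt with h | h
    · obtain ⟨i₁, hi₁⟩ := Finset.card_eq_one.1 h.symm
      obtain rfl : i₀ = i₁ := by simpa [hi₁] using hmem
      have h₁ := hone j hj
      rw [hi₁, Finset.sum_singleton] at h₁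
      rw [hi₁, Finset.sum_singleton, h₁, hi₀]
      simp
    · have h₁ : |∑ i ∈ S j, y i * (J i).elim 0 f| ≤ M := by
        calc |∑ i ∈ S j, y i * (J i).elim 0 f| ≤ ∑ i ∈ S j, |y i * (J i).elim 0 f| :=
              Finset.abs_sum_le_sum_abs _ _
          _ ≤ ∑ i ∈ S j, y i * M := Finset.sum_le_sum fun i hi => by
              rw [abs_mul, abs_of_nonneg (hy i)]
              exact mul_le_mul_of_nonneg_left (hF i hi) (hy i)
          _ = M := by rw [← Finset.sum_mul, hone j hj, one_mul]
      have h₂ : |f (j, χ j)| ≤ M := hf i₀ _ hi₀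
      have h₃ := abs_sub (∑ i ∈ S j, y i * (J i).elim 0 f) (f (j, χ j))
      have h₄ : (2 : ℚ) ≤ (S j).card := by exact_mod_cast h
      nlinarith
  have htotal : ∑ j ∈ Finset.range n, ((S j).card : ℚ) ≤ n + m := by
    have : ∑ j ∈ Finset.range n, (S j).card ≤ Fintype.card ι := by
      rw [← Finset.card_biUnion hdisj]
      exact Finset.card_le_univ _
    exact_mod_cast this.trans hcard
  rw [hsplit, ← Finset.sum_sub_distrib]
  calc |∑ j ∈ Finset.range n, (∑ i ∈ S j, y i * (J i).elim 0 f - f (j, χ j))|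
      ≤ ∑ j ∈ Finset.range n, |∑ i ∈ S j, y i * (J i).elim 0 f - f (j, χ j)| :=
        Finset.abs_sum_le_sum_abs _ _
    _ ≤ ∑ j ∈ Finset.range n, 2 * M * (((S j).card : ℚ) - 1) :=
        Finset.sum_le_sum fun j hj => herr j (Finset.mem_range.1 hj)
    _ = 2 * M * (∑ j ∈ Finset.range n, ((S j).card : ℚ) - n) := by
        rw [← Finset.mul_sum, Finset.sum_sub_distrib]
        simp
    _ ≤ 2 * m * M := by nlinarith

/-- The default color 0 is returned only if no label of item `j` has positive weight, which the
hypothesis excludes. -/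
theorem exists_pickColor {N : ℕ} {τ : Fin N → Option (ℕ × ℕ)} {ξ : Fin N → ℤ} {j : ℕ}
    (h : ∃ i r, τ i = some (j, r) ∧ 0 < ξ i) :
    ∃ i, τ i = some (j, pickColor j (List.ofFn τ) (List.ofFn ξ)) ∧ 0 < ξ i := by
  have key : ∀ l : List (Option (ℕ × ℕ) × ℤ), (∃ r z, (some (j, r), z) ∈ l ∧ 0 < z) →
      ∃ z, (some (j, l.foldr (fun p s =>
        if p.1.toList.isEmpty = false ∧ (p.1.toList.headD (0, 0)).1 = j ∧ 0 < p.2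
        then (p.1.toList.headD (0, 0)).2 else s) 0), z) ∈ l ∧ 0 < z := by
    intro l
    induction l with
    | nil => simp
    | cons p l ih =>
      rintro ⟨r, z, hm, hz⟩
      rw [List.foldr_cons]
      split_ifs with hp
      · obtain ⟨e, z'⟩ := p
        cases e with
        | none => simp at hp
        | some q =>
          obtain ⟨j', r'⟩ := q
          simp only [Option.toList_some, List.headD_cons] at hp ⊢
          obtain ⟨-, rfl, hz'⟩ := hp
          exact ⟨z', by simp, hz'⟩
      · rcases List.mem_cons.1 hm with rfl | hm
        · exact absurd ⟨rfl, rfl, hz⟩ hp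
        · obtain ⟨z', h₁, h₂⟩ := ih ⟨r, z, hm, hz⟩
          exact ⟨z', List.mem_cons_of_mem _ h₁, h₂⟩
  obtain ⟨i, r, hi, hpos⟩ := h
  obtain ⟨z, h₁, h₂⟩ := key ((List.ofFn τ).zip (List.ofFn ξ))
    ⟨r, ξ i, by rw [zip_ofFn]; exact List.mem_ofFn.2 ⟨i, by rw [hi]⟩, hpos⟩
  rw [zip_ofFn] at h₁
  obtain ⟨i', hi'⟩ := List.mem_ofFn.1 h₁
  rw [← zip_ofFn, Prod.mk.injEq] at hi'
  exact ⟨i', hi'.1, hi'.2 ▸ h₂⟩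

end MultiColor

/-! ### From the last tableau to the coloring -/

namespace MultiColor
open Matrix

namespace Input

variable (I : Input)

theorem sum_map_ids {M : Type} [AddCommMonoid M] (F : ℕ × ℕ → M) :
    (I.ids.map F).sum = ∑ j ∈ Finset.range I.n, ∑ r ∈ Finset.range I.c, F (j, r) := by
  rw [ids, List.map_flatMap, List.flatMap_def, List.sum_flatten]
  simp only [List.map_map]
  rfl

theorem sum_col_apply (k : Fin (I.n + I.m)) :
    (I.ids.map I.col).sum k = (I.ids.map fun id => I.col id k).sum := by
  induction I.ids with
  | nil => rfl
  | cons id l ih => simp [ih]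

theorem commonDen_pos : 0 < I.commonDen := by
  refine Nat.pos_of_ne_zero fun h => ?_
  rw [commonDen, List.prod_eq_zero_iff] at h
  simp [fractions, List.mem_ofFn] at h

theorem den_dvd_commonDen (j : Fin I.n) (r : Fin I.c) (i : Fin I.m) :
    (I.v j r i).den ∣ I.commonDen := by
  refine List.dvd_prod (List.mem_map.2 ⟨((I.v j r i).num, (I.v j r i).den), ?_, rfl⟩)
  simp only [fractions, List.mem_flatten, List.mem_ofFn]
  exact ⟨_, ⟨_, ⟨j, rfl⟩, List.mem_ofFn.2 ⟨r, rfl⟩⟩, List.mem_ofFn.2 ⟨i, rfl⟩⟩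

theorem entry_eq (j : Fin I.n) (r : Fin I.c) (i : Fin I.m) :
    (I.entry (j, r) i : ℚ) = I.commonDen * I.v j r i := by
  have h : (I.v j r i).den ∣ I.commonDen := I.den_dvd_commonDen j r i
  have hd : ((I.v j r i).den : ℚ) ≠ 0 := by exact_mod_cast (I.v j r i).den_ne_zero
  rw [entry, dif_pos ⟨j.2, r.2⟩]
  change (((I.v j r i).num * (I.commonDen / (I.v j r i).den : ℕ) : ℤ) : ℚ) = _
  rw [Int.cast_mul, Int.cast_natCast, Nat.cast_div h hd]
  conv_rhs => rw [← Rat.num_div_den (I.v j r i)]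
  field_simp

/-- The coordinate `i` of the vector with a given label. -/
def coord (i : Fin I.m) (id : ℕ × ℕ) : ℚ := I.entry id i / I.commonDen

theorem coord_eq (j : Fin I.n) (r : Fin I.c) (i : Fin I.m) : I.coord i (j, r) = I.v j r i := by
  have : (I.commonDen : ℚ) ≠ 0 := by exact_mod_cast I.commonDen_pos.ne'
  rw [coord, entry_eq]
  field_simp

theorem abs_coord_le {id : ℕ × ℕ} (h : id ∈ I.ids) (i : Fin I.m) :
    |I.coord i id| ≤ I.maxAbs i := by
  obtain ⟨j, r⟩ := id
  have hm := I.mem_ids.1 h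
  have hj : j < I.n := hm.1
  have hr : r < I.c := hm.2
  clear hm h
  lift j to Fin I.n using hj
  lift r to Fin I.c using hr
  rw [coord_eq, maxAbs]
  exact Finset.le_sup' (fun p : Fin I.n × Fin I.c => |I.v p.1 p.2 i|) (Finset.mem_univ (j, r))

theorem maxAbs_nonneg (i : Fin I.m) : 0 ≤ I.maxAbs i :=
  (abs_nonneg _).trans (I.abs_coord_le (I.mem_ids.2 ⟨I.n_pos, I.c_pos⟩ : (0, 0) ∈ I.ids) i)

/-- The value that the last tableau gives to a color of an item. -/
def pick (j : ℕ) : ℕ := pickColor j I.final.2.1 I.final.2.2.1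

/-- The last tableau represents the sum of all columns with denominator `D`. Dividing its numerators
by `D * c` gives weights that add up to 1 on each item and reproduce the average of the vectors, so
the rounding estimate applies. -/
theorem pick_spec : (∀ j < I.n, I.pick j < I.c) ∧ ∀ i : Fin I.m,
    |(1 / (I.c : ℚ)) * ∑ j ∈ Finset.range I.n, ∑ r ∈ Finset.range I.c, I.coord i (j, r) -
      ∑ j ∈ Finset.range I.n, I.coord i (j, I.pick j)| ≤ 2 * (I.m : ℚ) * I.maxAbs i := by
  obtain ⟨B, τ, ξ, hD, -, hτ, hξ, hBξ, hpos, hart, -, hcol, -⟩ := I.valid_final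
  have hc : (0 : ℚ) < I.c := by exact_mod_cast I.c_pos
  have hP : (0 : ℚ) < I.commonDen := by exact_mod_cast I.commonDen_pos
  set D := I.final.1
  have hDq : (0 : ℚ) < D := by exact_mod_cast hD
  have hrow : ∀ k, ∑ i, (τ i).elim 0 (fun id => I.col id k) * ξ i =
      D * ∑ j ∈ Finset.range I.n, ∑ r ∈ Finset.range I.c, I.col (j, r) k := by
    intro k
    have := congrFun hBξ k
    rw [Pi.smul_apply, sum_col_apply, sum_map_ids, smul_eq_mul] at this
    rw [← this]
    refine Finset.sum_congr rfl fun i _ => ?_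
    cases hi : τ i with
    | none => simp [hart i hi]
    | some id => simp [(hcol i id hi).2 k]
  let y : Fin (I.n + I.m) → ℚ := fun i => ξ i / (D * I.c)
  -- Row `j` of the system: exactly `c` of all columns have the entry 1 there, and the others have
  -- 0.
  have hitem : ∀ j < I.n, ∑ i, (if (τ i).map Prod.fst = some j then ξ i else 0) = D * I.c := by
    intro j hj
    have := hrow (Fin.castAdd I.m ⟨j, hj⟩)
    simp only [col, Fin.append_left] at this
    rw [Finset.sum_eq_single_of_mem j (Finset.mem_range.2 hj)
      (fun j' _ h => by simp [h.symm])] at this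
    simp only [if_true, Finset.sum_const, Finset.card_range, nsmul_eq_mul, mul_one] at this
    rw [← this]
    refine Finset.sum_congr rfl fun i _ => ?_
    cases hi : τ i with
    | none => simp
    | some id => by_cases h : j = id.1 <;> simp [h, eq_comm]
  -- The nonnegative numerators of item `j` have the positive sum `D * c`, so one of them is
  -- positive.
  have hχ : ∀ j < I.n, ∃ i, τ i = some (j, I.pick j) ∧ 0 < ξ i := by
    intro j hj
    rw [pick, hτ, hξ]
    refine exists_pickColor ?_
    by_contra hcon
    push Not at hcon
    have h := hitem j hj
    rw [Finset.sum_eq_zero fun i _ => ?_] at h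
    · have : 0 < D * I.c := mul_pos hD (by exact_mod_cast I.c_pos)
      omega
    · split_ifs with hi
      · obtain ⟨id, hid, rfl⟩ := Option.map_eq_some_iff.1 hi
        exact le_antisymm (hcon i id.2 hid) (hpos i)
      · rfl
  refine ⟨fun j hj => ?_, fun i => ?_⟩
  · obtain ⟨i, hi, _⟩ := hχ j hj
    exact (I.mem_ids.1 (hcol i _ hi).1).2
  · have hsum : ∑ k, y k * (τ k).elim 0 (I.coord i) = (1 / (I.c : ℚ)) *
        ∑ j ∈ Finset.range I.n, ∑ r ∈ Finset.range I.c, I.coord i (j, r) := by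
      -- The rows after the first `n` carry the coordinates of the vectors, scaled by the common
      -- denominator, which is divided out again below.
      have h := hrow (Fin.natAdd I.n i)
      simp only [col, Fin.append_right] at h
      have h' : ∑ k, ((τ k).elim 0 (fun id => I.entry id i) : ℤ) * (ξ k : ℚ) =
          D * ∑ j ∈ Finset.range I.n, ∑ r ∈ Finset.range I.c, (I.entry (j, r) i : ℚ) := by
        exact_mod_cast h
      have h₁ : ∀ k, y k * (τ k).elim 0 (I.coord i) = (1 / (D * I.c * I.commonDen)) *
          (((τ k).elim 0 (fun id => I.entry id i) : ℤ) * (ξ k : ℚ)) := by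
        intro k
        cases τ k with
        | none => simp
        | some id =>
          simp only [Option.elim_some, coord, y]
          field_simp
      rw [Finset.sum_congr rfl fun k _ => h₁ k, ← Finset.mul_sum, h']
      simp only [coord, ← Finset.sum_div]
      field_simp
    rw [← hsum]
    refine abs_sum_sub_sum_le τ y I.n I.m (by simp) (fun k => ?_) (fun k hk => ?_)
      (fun k id hk => (I.mem_ids.1 (hcol k id hk).1).1) (fun j hj => ?_) I.pick (fun j hj => ?_)
      (I.coord i) (I.maxAbs i) (fun k id hk => I.abs_coord_le (hcol k id hk).1 i)
      (I.maxAbs_nonneg i)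
    · have : (0 : ℚ) ≤ ξ k := by exact_mod_cast hpos k
      positivity
    · simp [y, hart k hk]
    · have h : ∑ k, (if (τ k).map Prod.fst = some j then (ξ k : ℚ) else 0) = D * I.c := by
        exact_mod_cast hitem j hj
      rw [← div_self (mul_pos hDq hc).ne', ← h, Finset.sum_div, h]
      refine Finset.sum_congr rfl fun k _ => ?_
      split_ifs <;> simp [y]
    · obtain ⟨k, hk, hk'⟩ := hχ j hj
      have : (0 : ℚ) < ξ k := by exact_mod_cast hk'
      exact ⟨k, hk, by positivity⟩

end Input

end MultiColor

theorem mainTheorem5 :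
    ∃ χ : (I : MultiColor.Input) → Fin I.n → Fin I.c,
      Nonempty (Turing.TM2ComputableInPolyTime MultiColor.encodeInput MultiColor.encodeNatList
        (fun I => MultiColor.colorSeq (χ I))) ∧
      ∀ (I : MultiColor.Input) (i : Fin I.m),
        |(1 / (I.c : ℚ)) * ∑ j, ∑ r, I.v j r i - ∑ j, I.v j (χ I j) i|
          ≤ 2 * (I.m : ℚ) * I.maxAbs i := by
  refine ⟨fun I j => ⟨I.pick j, I.pick_spec.1 j j.2⟩, ?_, fun I i => ?_⟩
  · have h : (fun I : MultiColor.Input => MultiColor.colorSeq (n := I.n) (c := I.c) fun j =>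
        ⟨I.pick j, I.pick_spec.1 j j.2⟩) = MultiColor.Input.colors := by
      funext I
      refine List.ext_getElem ?_ fun k h₁ h₂ => ?_
      · simp [MultiColor.colorSeq, MultiColor.Input.colors]
      · simp [MultiColor.colorSeq, MultiColor.Input.colors, MultiColor.Input.pick]
    rw [h]
    exact MultiColor.Input.polyTime_colors.nonempty_computable
  · have h := I.pick_spec.2 i
    simp only [Finset.sum_range, MultiColor.Input.coord_eq] at h
    have h' : ∀ j : Fin I.n, I.coord i (j, I.pick j) =
        I.v j ⟨I.pick j, I.pick_spec.1 j j.2⟩ i := fun j =>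
      I.coord_eq j ⟨I.pick j, I.pick_spec.1 j j.2⟩ i
    simpa only [h'] using h
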